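/- Let $m,n,k\in\mathbb{N}=\{0,1,2,\dots\}$ and $M=m-2n$. Let $\mathcal{P}=\mathbb{R}[x_1,\dots,x_m]\otimes\Lambda_{2n}$ be the algebra of superpolynomials on $\mathbb{R}^{m|2n}$, where $\Lambda_{2n}$ is the real Grassmann algebra with anticommuting generators $\theta_1,\dots,\theta_{2n}$. Write $(X_1,\dots,X_{m+2n})=(x_1,\dots,x_m,\theta_1,\dots,\theta_{2n})$, $[i]=0$ if $i\le m$ and $[i]=1$ otherwise, let $\partial_{X_i}$ be the (left) partial derivatives, and put $$R^2=\sum_{i=1}^m x_i^2-\sum_{j=1}^n\theta_{2j-1}\theta_{2j},\qquad \nabla^2=\sum_{i=1}^m\partial_{x_i}^2-4\sum_{j=1}^n\partial_{\theta_{2j-1}}\partial_{\theta_{2j}},\qquad \mathbb{E}=\sum_{i=1}^{m+2n}X_i\partial_{X_i}.$$ The space of spherical harmonics of degree $k$ is $\mathcal{H}_k=\{P\in\mathcal{P}:\ \mathbb{E}P=kP,\ \nabla^2P=0\}$. The Lie superalgebra $\mathfrak{osp}(m|2n)$ acts on $\mathcal{P}$ as the real span of the operators $$L_{ij}=X_i\partial_{X^j}-(-1)^{[i][j]}X_j\partial_{X^i},\qquad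 1\le i,j\le m+2n,$$ where $\partial_{X^i}=\partial_{x_i}$ for $i\le m$, $\partial_{X^{m+2j-1}}=2\,\partial_{\theta_{2j}}$ and $\partial_{X^{m+2j}}=-2\,\partial_{\theta_{2j-1}}$ for $1\le j\le n$. A subspace of $\mathcal{P}$ is an $\mathfrak{osp}(m|2n)$-module if all these operators map it to itself; it is irreducible if it is non-zero and its only submodules are $0$ and itself. Assume that $k\le n$ if $m=0$ and that $k\le 2n+1$ if $m=1$ (no assumption is made if $m\ge2$; the values of $(m,n,k)$ that are excluded are those with $\mathcal{H}_k=\{0\}$). (a) If $M\notin-2\mathbb{N}$, then $\mathcal{H}_k$ is an irreducible $\mathfrak{osp}(m|2n)$-module. (b) If $M\in-2\mathbb{N}$, then $\mathcal{H}_k$ is an irreducible $\mathfrak{osp}(m|2n)$-module if and only if $k>2-M$ or $k<2-\frac M2$. Moreover, if $2-\frac M2\le k\le 2-M$, then $R^{2k+M-2}\mathcal{H}_{2-M-k}$ (the image of $\mathcal{H}_{2-M-k}$ under multiplication by the $(k+\frac M2-1)$-th power of $R^2$) is a non-zero $\mathfrak{osp}(m|2n)$-submodule of $\mathcal{H}_k$,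 different from $\mathcal{H}_k$. -/

import Mathlib

open scoped TensorProduct

noncomputable section

namespace SuperHarm

/-- Labels of the variables `X_1, …, X_{m+2n}` of `ℝ^{m|2n}`. `Sum.inl i` labels the commuting
variable `x_i`; `Sum.inr (j, 0)` and `Sum.inr (j, 1)` label the `j`-th pair of anticommuting
variables, `θ_{2j-1}` and `θ_{2j}` (pairs being counted from 1). -/
abbrev Idx (m n : ℕ) : Type := Fin m ⊕ (Fin n × Fin 2)

/-- The parity `[i]` of a variable: 0 for commuting, 1 for anticommuting. -/
def parity {m n : ℕ} : Idx m n → ℕ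
  | Sum.inl _ => 0
  | Sum.inr _ => 1

/-- The superdimension `M = m - 2n`. -/
def superdim (m n : ℕ) : ℤ := (m : ℤ) - 2 * (n : ℤ)

/-- The Grassmann algebra `Λ_{2n}` on `2n` anticommuting generators. -/
abbrev Grassmann (n : ℕ) : Type := ExteriorAlgebra ℝ (Fin n × Fin 2 → ℝ)

/-- The superpolynomials `𝒫 = ℝ[x_1, …, x_m] ⊗ Λ_{2n}`. -/
def SuperPoly (m n : ℕ) : Type := MvPolynomial (Fin m) ℝ ⊗[ℝ] Grassmann n

instance (m n : ℕ) : Ring (SuperPoly m n) :=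
  inferInstanceAs (Ring (MvPolynomial (Fin m) ℝ ⊗[ℝ] Grassmann n))

instance (m n : ℕ) : Algebra ℝ (SuperPoly m n) :=
  inferInstanceAs (Algebra ℝ (MvPolynomial (Fin m) ℝ ⊗[ℝ] Grassmann n))

/-- The variable `X_i`, as an element of `𝒫`. -/
def X {m n : ℕ} : Idx m n → SuperPoly m n
  | Sum.inl i => MvPolynomial.X i ⊗ₜ[ℝ] 1
  | Sum.inr a => 1 ⊗ₜ[ℝ] ExteriorAlgebra.ι ℝ (Pi.single a (1 : ℝ))

/-- Left multiplication by `f`, as a linear operator on `𝒫`. -/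
def mulOp {m n : ℕ} (f : SuperPoly m n) : Module.End ℝ (SuperPoly m n) :=
  LinearMap.mulLeft ℝ f

/-- The partial derivative `∂_{X_i}`. For a commuting variable it is the usual one; for an
anticommuting variable it is the left Grassmann derivative, that is, the contraction with the dual
basis vector: it kills `1` and satisfies `∂_a (θ_b ω) = δ_{ab} ω - θ_b ∂_a ω`. -/
def partialX {m n : ℕ} : Idx m n → Module.End ℝ (SuperPoly m n)
  | Sum.inl i => LinearMap.rTensor (Grassmann n) (MvPolynomial.pderiv (R := ℝ) i).toLinearMap
  | Sum.inr a => LinearMap.lTensor (MvPolynomial (Fin m) ℝ)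
      (CliffordAlgebra.contractLeft (Q := (0 : QuadraticForm ℝ (Fin n × Fin 2 → ℝ)))
        (LinearMap.proj a))

/-- The orthosymplectic metric `g`: the identity on the commuting labels, and `n` diagonal blocks
`½ (0, -1; 1, 0)` on the anticommuting ones. -/
def metric (m n : ℕ) : Matrix (Idx m n) (Idx m n) ℝ :=
  Matrix.fromBlocks 1 0 0
    (Matrix.of fun a b => if a.1 = b.1 then (!![0, -1 / 2; 1 / 2, 0] : Matrix _ _ ℝ) a.2 b.2 else 0)

/-- The inverse of the metric. -/
def metricInv (m n : ℕ) : Matrix (Idx m n) (Idx m n) ℝ :=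
  Matrix.fromBlocks 1 0 0
    (Matrix.of fun a b => if a.1 = b.1 then (!![0, 2; -2, 0] : Matrix _ _ ℝ) a.2 b.2 else 0)

theorem metric_mul_metricInv (m n : ℕ) : metric m n * metricInv m n = 1 := by
  rw [metric, metricInv, Matrix.fromBlocks_multiply]
  simp only [Matrix.mul_zero, Matrix.zero_mul, add_zero, zero_add, mul_one]
  rw [← Matrix.fromBlocks_one]
  congr 1
  ext ⟨j, a⟩ ⟨k, b⟩
  rw [Matrix.mul_apply, Fintype.sum_prod_type]
  simp only [Matrix.of_apply, ite_mul, zero_mul, mul_ite, mul_zero, Fin.sum_univ_two,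
    Matrix.one_apply, Prod.mk.injEq]
  by_cases h : j = k
  · subst h
    fin_cases a <;> fin_cases b <;> simp
  · fin_cases a <;> fin_cases b <;> simp [h]

/-- The variable `X^j = ∑_i X_i g^{ij}`, where `g^{ij}` is the entry of `g` at `(i, j)`. -/
def Xup {m n : ℕ} (j : Idx m n) : SuperPoly m n := ∑ i, metric m n i j • X i

/-- The derivative `∂_{X^j}` with respect to `X^j = ∑_i X_i g^{ij}`. By the chain rule it is
`∑_i (g⁻¹)_{ji} ∂_{X_i}`, that is, `∂_{x_j}` for commuting `x_j`, and `2 ∂_{θ_{2l}}` and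
`-2 ∂_{θ_{2l-1}}` for the labels of `θ_{2l-1}` and `θ_{2l}`. -/
def partialXup {m n : ℕ} (j : Idx m n) : Module.End ℝ (SuperPoly m n) :=
  ∑ i, metricInv m n j i • partialX i

/-- `R² = ∑_j X^j X_j = ∑_i x_i² - ∑_j θ_{2j-1} θ_{2j}`. -/
def Rsq (m n : ℕ) : SuperPoly m n := ∑ j, Xup j * X j

/-- The super Laplace operator `∇² = ∑_i ∂_{x_i}² - 4 ∑_j ∂_{θ_{2j-1}} ∂_{θ_{2j}}`. -/
def laplace (m n : ℕ) : Module.End ℝ (SuperPoly m n) :=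
  (∑ i : Fin m, partialX (Sum.inl i) * partialX (Sum.inl i)) -
    (4 : ℝ) • ∑ j : Fin n, partialX (Sum.inr (j, 0)) * partialX (Sum.inr (j, 1))

/-- The super Euler operator `𝔼 = ∑_i X_i ∂_{X_i}`. -/
def euler (m n : ℕ) : Module.End ℝ (SuperPoly m n) := ∑ i, mulOp (X i) * partialX i

/-- The space `𝒫_k` of superpolynomials `P` with `𝔼 P = k P`. -/
def homog (m n k : ℕ) : Submodule ℝ (SuperPoly m n) :=
  LinearMap.ker (euler m n - (k : ℝ) • (1 : Module.End ℝ (SuperPoly m n)))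

/-- The spherical harmonics of degree `k`: `ℋ_k = 𝒫_k ∩ ker ∇²`. -/
def sphHarm (m n k : ℕ) : Submodule ℝ (SuperPoly m n) := homog m n k ⊓ LinearMap.ker (laplace m n)

/-- The operators `L_{ij} = X_i ∂_{X^j} - (-1)^{[i][j]} X_j ∂_{X^i}`. -/
def L {m n : ℕ} (i j : Idx m n) : Module.End ℝ (SuperPoly m n) :=
  mulOp (X i) * partialXup j - ((-1 : ℝ) ^ (parity i * parity j)) • (mulOp (X j) * partialXup i)

/-- The orthosymplectic Lie superalgebra `𝔬𝔰𝔭(m|2n)`, acting on `𝒫`: the real span of the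
operators `L_{ij}`, of parity `[i] + [j]`, inside the Lie superalgebra of linear operators with the
supercommutator. -/
def osp (m n : ℕ) : Submodule ℝ (Module.End ℝ (SuperPoly m n)) :=
  Submodule.span ℝ (Set.range fun p : Idx m n × Idx m n => L p.1 p.2)

/-- A subspace of `𝒫` is an `𝔬𝔰𝔭(m|2n)`-module if `𝔬𝔰𝔭(m|2n)` maps it to itself. -/
def IsOspModule {m n : ℕ} (V : Submodule ℝ (SuperPoly m n)) : Prop :=
  ∀ D ∈ osp m n, ∀ f ∈ V, D f ∈ V

/-- An `𝔬𝔰𝔭(m|2n)`-module `V ⊆ 𝒫` is irreducible if it is non-zero and its only submodules are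
`0` and `V`. -/
def IsOspIrreducible {m n : ℕ} (V : Submodule ℝ (SuperPoly m n)) : Prop :=
  IsOspModule V ∧ V ≠ ⊥ ∧ ∀ W ≤ V, IsOspModule W → W = ⊥ ∨ W = V

/-- The image `R^{2s} V` of a subspace `V` under multiplication by the `s`-th power of `R²`. -/
def RsqPowMul {m n : ℕ} (s : ℕ) (V : Submodule ℝ (SuperPoly m n)) : Submodule ℝ (SuperPoly m n) :=
  V.map (mulOp (Rsq m n ^ s))

end SuperHarm

end

/-! The symmetric bilinear form `form` makes multiplication by X_i adjoint to a multiple of ∂_{X_i},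
with constants chosen so that R² is adjoint to ∇² and each L_{ij} is adjoint to a nonzero multiple
of L_{bar i, bar j} (`form_L`). Orthogonal complements of modules are therefore modules. Once there
are θ's the form is indefinite; positivity is replaced by `exists_form_ne_zero`: outside the
exceptional degrees, two nonzero stable subspaces of ℋ_k are never orthogonal. Applied to a nonzero
submodule W and to W^⊥ ∩ ℋ_k, it gives W^⊥ ∩ ℋ_k = 0, so ℋ_k embeds into the dual of W and W = ℋ_k
by dimension.

Non-orthogonality is proved by induction on the set S of available pairs of θ's. Over a new pair
(θ_0, θ_1), write f = A + θ_0 B + θ_1 C + θ_0 θ_1 D. The operators L_{00}, L_{01} and L_{0j} show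
that a nonzero stable subspace contains either some θ_0 B ≠ 0, with B harmonic of degree k - 1 in
the old variables, or an "almost invariant" vector A + θ_0 θ_1 D with ∂_{X^j} A = -2 X_j D for all
old j (`exists_singular`). If both subspaces are of the first type, the induction hypothesis for the
B's suffices, as ⟨θ_0 f, θ_0 g⟩ = 2⟨f, g⟩. For the second type, kA = -2 R_S² D, D is annihilated by
the old L_{ij}, and applying ∇² forces k + m = 4 + 2|S|. For even m this is an exceptional degree;
for odd m ≥ 3 there is no such invariant D (`eq_zero_of_invariant`); for m = 1 it is the top degree,
where the first type cannot occur (`harmIn_eq_bot_of_one`) and the form is computed directly from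
⟨D, D'⟩ (`form_almost_invariant`). With no θ's left, the claim is classical: every nonzero
rotation-stable space of harmonics contains a nonzero zonal one, and zonal harmonics of a given
degree are proportional.

In the exceptional degrees, ∇²(R^{2s} f) is 2s(M + 2d + 2s - 2) R^{2s-2} f for f harmonic of degree
d, and the factor vanishes for d = 2 - M - k, s = k + M/2 - 1. The submodule R^{2s} ℋ_d is nonzero
because R² modulo the θ's is a nonzero polynomial. It is proper because R²𝒫 is orthogonal to ℋ_k,
while ℋ_k contains a nonzero classical harmonic u, for which ⟨u, u⟩ > 0. -/

namespace SuperHarm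

variable {m n : ℕ}

/-! ### Commutation relations -/

/-- The sign `(-1)^{[i][j]}`. -/
noncomputable def sgn (i j : Idx m n) : ℝ := (-1 : ℝ) ^ (parity i * parity j)

@[simp] theorem sgn_inl_left (i : Fin m) (j : Idx m n) : sgn (Sum.inl i) j = 1 := by
  simp [sgn, parity]

@[simp] theorem sgn_inl_right (i : Idx m n) (j : Fin m) : sgn i (Sum.inl j) = 1 := by
  simp [sgn, parity]

@[simp] theorem sgn_inr (a b : Fin n × Fin 2) : sgn (m := m) (Sum.inr a) (Sum.inr b) = -1 := by
  simp [sgn, parity]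

theorem sgn_comm (i j : Idx m n) : sgn i j = sgn j i := by
  simp [sgn, mul_comm]

theorem sgn_mul_self (i j : Idx m n) : sgn i j * sgn i j = 1 := by
  rw [sgn, ← mul_pow]; simp

/-- The pure tensor `p ⊗ ω`, as a superpolynomial. -/
noncomputable def tm (p : MvPolynomial (Fin m) ℝ) (w : Grassmann n) : SuperPoly m n := p ⊗ₜ[ℝ] w

theorem tm_induction {C : SuperPoly m n → Prop} (h0 : C 0) (ht : ∀ p w, C (tm p w))
    (ha : ∀ f g, C f → C g → C (f + g)) (f : SuperPoly m n) : C f :=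
  TensorProduct.induction_on (motive := fun f => C f) f h0 ht ha

theorem tm_mul (p q : MvPolynomial (Fin m) ℝ) (w v : Grassmann n) :
    tm p w * tm q v = tm (p * q) (w * v) :=
  Algebra.TensorProduct.tmul_mul_tmul p q w v

theorem tm_one : tm (1 : MvPolynomial (Fin m) ℝ) (1 : Grassmann n) = 1 := rfl

theorem tm_add_left (p q : MvPolynomial (Fin m) ℝ) (w : Grassmann n) :
    tm (p + q) w = tm p w + tm q w := TensorProduct.add_tmul p q w

theorem tm_add_right (p : MvPolynomial (Fin m) ℝ) (w v : Grassmann n) :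
    tm p (w + v) = tm p w + tm p v := TensorProduct.tmul_add p w v

theorem tm_smul_left (c : ℝ) (p : MvPolynomial (Fin m) ℝ) (w : Grassmann n) :
    tm (c • p) w = c • tm p w := TensorProduct.smul_tmul' c p w

theorem tm_smul_right (c : ℝ) (p : MvPolynomial (Fin m) ℝ) (w : Grassmann n) :
    tm p (c • w) = c • tm p w := TensorProduct.tmul_smul c p w

theorem tm_zero_left (w : Grassmann n) : tm (0 : MvPolynomial (Fin m) ℝ) w = 0 :=
  TensorProduct.zero_tmul _ w

theorem tm_zero_right (p : MvPolynomial (Fin m) ℝ) : tm p (0 : Grassmann n) = 0 :=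
  TensorProduct.tmul_zero _ p

theorem tm_sub_right (p : MvPolynomial (Fin m) ℝ) (w v : Grassmann n) :
    tm p (w - v) = tm p w - tm p v := TensorProduct.tmul_sub p w v

theorem tm_neg_right (p : MvPolynomial (Fin m) ℝ) (w : Grassmann n) :
    tm p (-w) = -tm p w := TensorProduct.tmul_neg p w

/-- The generator `θ_a` of the Grassmann algebra. -/
noncomputable def th (a : Fin n × Fin 2) : Grassmann n := ExteriorAlgebra.ι ℝ (Pi.single a (1 : ℝ))

/-- The derivative `∂_{θ_a}` on the Grassmann algebra. -/
noncomputable def dth (a : Fin n × Fin 2) : Grassmann n →ₗ[ℝ] Grassmann n :=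
  CliffordAlgebra.contractLeft (Q := (0 : QuadraticForm ℝ (Fin n × Fin 2 → ℝ)))
    (LinearMap.proj a)

theorem X_inl (i : Fin m) : X (n := n) (Sum.inl i) = tm (MvPolynomial.X i) 1 := rfl

theorem X_inr (a : Fin n × Fin 2) : X (m := m) (Sum.inr a) = tm 1 (th a) := rfl

theorem partialX_inl_tm (i : Fin m) (p : MvPolynomial (Fin m) ℝ) (w : Grassmann n) :
    partialX (Sum.inl i) (tm p w) = tm (MvPolynomial.pderiv i p) w := rfl

theorem partialX_inr_tm (a : Fin n × Fin 2) (p : MvPolynomial (Fin m) ℝ) (w : Grassmann n) :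
    partialX (Sum.inr a) (tm p w) = tm p (dth a w) := rfl

theorem dth_ι_mul (a : Fin n × Fin 2) (v : Fin n × Fin 2 → ℝ) (w : Grassmann n) :
    dth a (ExteriorAlgebra.ι ℝ v * w) = v a • w - ExteriorAlgebra.ι ℝ v * dth a w :=
  CliffordAlgebra.contractLeft_ι_mul (Q := (0 : QuadraticForm ℝ (Fin n × Fin 2 → ℝ)))
    (LinearMap.proj a) v w

theorem dth_th_mul (a b : Fin n × Fin 2) (w : Grassmann n) :
    dth a (th b * w) = (if a = b then w else 0) - th b * dth a w := by
  rw [th, dth_ι_mul]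
  by_cases h : a = b
  · subst h; simp
  · simp [h]

theorem dth_comm (a b : Fin n × Fin 2) (w : Grassmann n) : dth a (dth b w) = -dth b (dth a w) :=
  CliffordAlgebra.contractLeft_comm (Q := (0 : QuadraticForm ℝ (Fin n × Fin 2 → ℝ))) _ _ w

theorem dth_algebraMap (a : Fin n × Fin 2) (r : ℝ) : dth a (algebraMap ℝ (Grassmann n) r) = 0 :=
  CliffordAlgebra.contractLeft_algebraMap (Q := (0 : QuadraticForm ℝ (Fin n × Fin 2 → ℝ))) _ r

theorem th_mul_th (a b : Fin n × Fin 2) : th a * th b = -(th b * th a) :=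
  eq_neg_of_add_eq_zero_left (ExteriorAlgebra.ι_add_mul_swap _ _)

theorem ι_eq_sum_th (v : Fin n × Fin 2 → ℝ) : ExteriorAlgebra.ι ℝ v = ∑ a, v a • th a := by
  conv_lhs => rw [← Finset.univ_sum_single v]
  rw [map_sum]
  refine Finset.sum_congr rfl fun a _ => ?_
  rw [th, ← map_smul]
  congr 1
  ext b
  by_cases h : b = a
  · subst h; simp
  · simp [h]

theorem grassmann_induction {C : Grassmann n → Prop} (hr : ∀ r : ℝ, C (algebraMap ℝ _ r))
    (ha : ∀ w v, C w → C v → C (w + v)) (hm : ∀ v w, C w → C (ExteriorAlgebra.ι ℝ v * w))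
    (w : Grassmann n) : C w :=
  CliffordAlgebra.left_induction (Q := (0 : QuadraticForm ℝ (Fin n × Fin 2 → ℝ)))
    (P := C) hr ha (fun x v h => hm v x h) w

theorem X_mul_X (i j : Idx m n) : X i * X j = sgn i j • (X j * X i) := by
  rcases i with i | a <;> rcases j with j | b
  · simp [X_inl, tm_mul, mul_comm]
  · simp [X_inl, X_inr, tm_mul]
  · simp [X_inl, X_inr, tm_mul]
  · rw [X_inr, X_inr, tm_mul, tm_mul, th_mul_th, tm_neg_right, sgn_inr, neg_one_smul]

theorem X_mul_X_mul (i j : Idx m n) (f : SuperPoly m n) :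
    X i * (X j * f) = sgn i j • (X j * (X i * f)) := by
  rw [← mul_assoc, X_mul_X, smul_mul_assoc, mul_assoc]

theorem partialX_X_mul (i j : Idx m n) (f : SuperPoly m n) :
    partialX i (X j * f) = (if i = j then f else 0) + sgn i j • (X j * partialX i f) := by
  induction f using tm_induction with
  | h0 => simp
  | ha f g hf hg =>
    rw [mul_add, map_add, hf, hg, map_add, mul_add, smul_add]
    split_ifs <;> abel
  | ht p w =>
    rcases i with i | a <;> rcases j with j | b
    · rw [X_inl, tm_mul, partialX_inl_tm, partialX_inl_tm, tm_mul, Derivation.leibniz, tm_add_left,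
        add_comm, MvPolynomial.pderiv_X]
      by_cases h : i = j
      · subst h; simp
      · simp [h, tm_zero_left, Ne.symm h]
    · rw [X_inr, tm_mul, partialX_inl_tm, partialX_inl_tm, tm_mul]
      simp
    · rw [X_inl, tm_mul, partialX_inr_tm, partialX_inr_tm, tm_mul]
      simp
    · rw [X_inr, tm_mul, partialX_inr_tm, partialX_inr_tm, tm_mul, dth_th_mul, tm_sub_right]
      by_cases h : a = b
      · subst h; simp [sub_eq_add_neg]
      · simp [h, tm_zero_right]

theorem pderiv_comm (i j : Fin m) (p : MvPolynomial (Fin m) ℝ) :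
    MvPolynomial.pderiv i (MvPolynomial.pderiv j p) =
      MvPolynomial.pderiv j (MvPolynomial.pderiv i p) := by
  by_cases h : i = j
  · rw [h]
  · ext d
    simp only [MvPolynomial.coeff_pderiv, Finsupp.add_apply, Finsupp.single_apply, h, Ne.symm h,
      if_false, add_zero, add_right_comm]
    ring

theorem partialX_comm (i j : Idx m n) (f : SuperPoly m n) :
    partialX i (partialX j f) = sgn i j • partialX j (partialX i f) := by
  induction f using tm_induction with
  | h0 => simp
  | ha f g hf hg => simp only [map_add, hf, hg, smul_add]
  | ht p w =>
    rcases i with i | a <;> rcases j with j | b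
    · rw [partialX_inl_tm, partialX_inl_tm, partialX_inl_tm, partialX_inl_tm, sgn_inl_left,
        one_smul, pderiv_comm]
    · simp [partialX_inl_tm, partialX_inr_tm]
    · simp [partialX_inl_tm, partialX_inr_tm]
    · simp only [partialX_inr_tm, sgn_inr]
      rw [dth_comm, tm_neg_right, neg_one_smul]

theorem partialX_one (i : Idx m n) : partialX i (1 : SuperPoly m n) = 0 := by
  rw [← tm_one]
  rcases i with i | a
  · rw [partialX_inl_tm, MvPolynomial.pderiv_one, tm_zero_left]
  · rw [partialX_inr_tm, ← map_one (algebraMap ℝ (Grassmann n)), dth_algebraMap, tm_zero_right]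

/-- Everything is obtained from 1 by left multiplication by variables. This is the source of
induction on superpolynomials and of the description of the Euler eigenspaces. -/
theorem eq_top_of_X_mul_mem (T : Submodule ℝ (SuperPoly m n)) (h1 : (1 : SuperPoly m n) ∈ T)
    (hX : ∀ i, ∀ f ∈ T, X i * f ∈ T) : T = ⊤ := by
  have hp : ∀ p : MvPolynomial (Fin m) ℝ, tm p (1 : Grassmann n) ∈ T := by
    intro p
    induction p using MvPolynomial.induction_on with
    | C a =>
      rw [MvPolynomial.C_eq_smul_one, tm_smul_left, tm_one]
      exact T.smul_mem _ h1
    | add p q hp hq => rw [tm_add_left]; exact T.add_mem hp hq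
    | mul_X p i hp =>
      have := hX (Sum.inl i) _ hp
      rwa [X_inl, tm_mul, mul_one, mul_comm] at this
  have hw : ∀ (w : Grassmann n) (p : MvPolynomial (Fin m) ℝ), tm p w ∈ T := by
    intro w
    induction w using grassmann_induction with
    | hr r =>
      intro p
      rw [Algebra.algebraMap_eq_smul_one, tm_smul_right]
      exact T.smul_mem _ (hp p)
    | ha w v hw hv => intro p; rw [tm_add_right]; exact T.add_mem (hw p) (hv p)
    | hm v w hw =>
      intro p
      have : tm p (ExteriorAlgebra.ι ℝ v * w) = ∑ a, v a • (X (Sum.inr a) * tm p w) := by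
        rw [ι_eq_sum_th, Finset.sum_mul]
        simp only [X_inr, tm_mul, one_mul, ← tm_smul_right, smul_mul_assoc]
        exact TensorProduct.tmul_sum p _ _
      rw [this]
      exact T.sum_mem fun a _ => T.smul_mem _ (hX _ _ (hw p))
  rw [eq_top_iff]
  intro f _
  induction f using tm_induction with
  | h0 => exact T.zero_mem
  | ht p w => exact hw w p
  | ha f g hf hg => exact T.add_mem (hf trivial) (hg trivial)

theorem superPoly_induction {C : SuperPoly m n → Prop} (h1 : C 1)
    (hs : ∀ (c : ℝ) f, C f → C (c • f)) (ha : ∀ f g, C f → C g → C (f + g))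
    (hX : ∀ i f, C f → C (X i * f)) (f : SuperPoly m n) : C f := by
  let T : Submodule ℝ (SuperPoly m n) :=
    { carrier := {f | C f}
      add_mem' := fun hf hg => ha _ _ hf hg
      zero_mem' := by simpa using hs 0 1 h1
      smul_mem' := fun c f hf => hs c f hf }
  have := eq_top_of_X_mul_mem T h1 (fun i f hf => hX i f hf)
  exact (this ▸ Submodule.mem_top : f ∈ T)

/-! ### The operators `∂_{X^i}`, `𝔼`, `∇²` and `L_{ij}` -/

/-- The label of the variable paired with `X_i` by the metric. -/
def bar : Idx m n → Idx m n
  | Sum.inl i => Sum.inl i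
  | Sum.inr a => Sum.inr (a.1, if a.2 = 0 then 1 else 0)

/-- The scalar for which `∂_{X^i} = lam i • ∂_{X_{bar i}}`. -/
def lam : Idx m n → ℝ
  | Sum.inl _ => 1
  | Sum.inr a => if a.2 = 0 then 2 else -2

@[simp] theorem bar_inl (i : Fin m) : bar (n := n) (Sum.inl i) = Sum.inl i := rfl

@[simp] theorem bar_inr_zero (j : Fin n) : bar (m := m) (Sum.inr (j, 0)) = Sum.inr (j, 1) := rfl

@[simp] theorem bar_inr_one (j : Fin n) : bar (m := m) (Sum.inr (j, 1)) = Sum.inr (j, 0) := rfl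

@[simp] theorem lam_inl (i : Fin m) : lam (n := n) (Sum.inl i) = 1 := rfl

@[simp] theorem lam_inr_zero (j : Fin n) : lam (m := m) (Sum.inr (j, 0)) = 2 := by simp [lam]

@[simp] theorem lam_inr_one (j : Fin n) : lam (m := m) (Sum.inr (j, 1)) = -2 := by simp [lam]

@[elab_as_elim]
theorem idx_cases {C : Idx m n → Prop} (hx : ∀ i, C (Sum.inl i)) (h0 : ∀ j, C (Sum.inr (j, 0)))
    (h1 : ∀ j, C (Sum.inr (j, 1))) (i : Idx m n) : C i := by
  rcases i with i | ⟨j, e⟩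
  · exact hx i
  · fin_cases e
    · exact h0 j
    · exact h1 j

@[simp] theorem bar_bar (i : Idx m n) : bar (bar i) = i := by
  induction i using idx_cases <;> simp

theorem lam_ne_zero (i : Idx m n) : lam i ≠ 0 := by
  induction i using idx_cases <;> simp

@[simp] theorem parity_bar (i : Idx m n) : parity (bar i) = parity i := by
  induction i using idx_cases <;> simp [parity]

@[simp] theorem sgn_bar_left (i j : Idx m n) : sgn (bar i) j = sgn i j := by simp [sgn]

@[simp] theorem sgn_bar_right (i j : Idx m n) : sgn i (bar j) = sgn i j := by simp [sgn]

theorem partialXup_apply (i : Idx m n) (f : SuperPoly m n) :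
    partialXup i f = lam i • partialX (bar i) f := by
  induction i using idx_cases with
  | hx i => simp [partialXup, metricInv, Matrix.one_apply]
  | h0 j => simp [partialXup, metricInv, Fintype.sum_prod_type]
  | h1 j => simp [partialXup, metricInv, Fintype.sum_prod_type]

theorem euler_apply (f : SuperPoly m n) : euler m n f = ∑ i, X i * partialX i f := by
  simp [euler, mulOp]

theorem laplace_apply (f : SuperPoly m n) :
    laplace m n f = (∑ i : Fin m, partialX (Sum.inl i) (partialX (Sum.inl i) f)) -
      (4 : ℝ) • ∑ j : Fin n, partialX (Sum.inr (j, 0)) (partialX (Sum.inr (j, 1)) f) := by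
  simp [laplace]

theorem L_apply (i j : Idx m n) (f : SuperPoly m n) :
    L i j f = X i * partialXup j f - sgn i j • (X j * partialXup i f) := by
  simp [L, mulOp, sgn]

theorem euler_X_mul (i : Idx m n) (f : SuperPoly m n) :
    euler m n (X i * f) = X i * euler m n f + X i * f := by
  rw [euler_apply, euler_apply, Finset.mul_sum]
  simp only [partialX_X_mul, mul_add, Finset.sum_add_distrib, mul_ite, mul_zero,
    Finset.sum_ite_eq', Finset.mem_univ, if_true]
  rw [add_comm]
  congr 1
  refine Finset.sum_congr rfl fun j _ => ?_
  rw [mul_smul_comm, X_mul_X_mul j i, smul_smul, sgn_mul_self, one_smul]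

theorem partialX_euler (i : Idx m n) (f : SuperPoly m n) :
    partialX i (euler m n f) = euler m n (partialX i f) + partialX i f := by
  rw [euler_apply, euler_apply, map_sum]
  simp only [partialX_X_mul, Finset.sum_add_distrib, Finset.sum_ite_eq, Finset.mem_univ, if_true]
  rw [add_comm]
  congr 1
  refine Finset.sum_congr rfl fun j _ => ?_
  rw [partialX_comm i j, mul_smul_comm, smul_smul, sgn_mul_self, one_smul]

theorem partialXup_X_mul (i j : Idx m n) (f : SuperPoly m n) :
    partialXup i (X j * f) = (if bar i = j then lam i • f else 0) +
      sgn i j • (X j * partialXup i f) := by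
  rw [partialXup_apply, partialX_X_mul, partialXup_apply, smul_add, sgn_bar_left, mul_smul_comm,
    smul_comm (lam i)]
  split_ifs <;> simp

theorem partialXup_comm (i j : Idx m n) (f : SuperPoly m n) :
    partialXup i (partialXup j f) = sgn i j • partialXup j (partialXup i f) := by
  simp only [partialXup_apply, map_smul]
  rw [partialX_comm, sgn_bar_left, sgn_bar_right]
  module

theorem partialXup_euler (i : Idx m n) (f : SuperPoly m n) :
    partialXup i (euler m n f) = euler m n (partialXup i f) + partialXup i f := by
  simp only [partialXup_apply, map_smul, partialX_euler, smul_add]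

theorem partialX_laplace (i : Idx m n) (f : SuperPoly m n) :
    partialX i (laplace m n f) = laplace m n (partialX i f) := by
  simp only [laplace_apply, map_sub, map_smul, map_sum]
  congr 1
  · refine Finset.sum_congr rfl fun j _ => ?_
    rw [partialX_comm i, partialX_comm i]; simp
  · congr 1
    refine Finset.sum_congr rfl fun j _ => ?_
    rw [partialX_comm i, partialX_comm i]
    rcases i with i | a <;> simp

theorem partialXup_laplace (i : Idx m n) (f : SuperPoly m n) :
    partialXup i (laplace m n f) = laplace m n (partialXup i f) := by
  simp only [partialXup_apply, map_smul, partialX_laplace]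

/-- The commutator of ∇² with X_i brings in the metric: this is how the derivatives occurring in
L_{ij} arise. -/
theorem laplace_X_mul (i : Idx m n) (f : SuperPoly m n) :
    laplace m n (X i * f) = X i * laplace m n f + (2 : ℝ) • partialXup i f := by
  rw [laplace_apply, laplace_apply, partialXup_apply]
  induction i using idx_cases with
  | hx i =>
    have h : ∀ l : Fin m, partialX (Sum.inl l) (partialX (Sum.inl l) (X (Sum.inl i) * f)) =
        X (Sum.inl i) * partialX (Sum.inl l) (partialX (Sum.inl l) f) +
          if l = i then (2 : ℝ) • partialX (Sum.inl l) f else 0 := by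
      intro l
      by_cases hl : l = i
      · subst hl; simp [partialX_X_mul, two_smul]; abel
      · simp [partialX_X_mul, hl]
    simp only [h, Finset.sum_add_distrib]
    simp [partialX_X_mul, mul_sub, Finset.mul_sum]
    abel
  | h0 i =>
    have h : ∀ l : Fin n, partialX (Sum.inr (l, 0)) (partialX (Sum.inr (l, 1))
        (X (Sum.inr (i, 0)) * f)) =
        X (Sum.inr (i, 0)) * partialX (Sum.inr (l, 0)) (partialX (Sum.inr (l, 1)) f) -
          if l = i then partialX (Sum.inr (l, 1)) f else 0 := by
      intro l
      by_cases hl : l = i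
      · subst hl; simp [partialX_X_mul, sub_eq_add_neg]
      · simp [partialX_X_mul, hl]
    simp only [h, Finset.sum_sub_distrib]
    simp [partialX_X_mul, mul_sub, Finset.mul_sum, smul_sub, smul_smul]
    norm_num
    abel
  | h1 i =>
    have h : ∀ l : Fin n, partialX (Sum.inr (l, 0)) (partialX (Sum.inr (l, 1))
        (X (Sum.inr (i, 1)) * f)) =
        X (Sum.inr (i, 1)) * partialX (Sum.inr (l, 0)) (partialX (Sum.inr (l, 1)) f) +
          if l = i then partialX (Sum.inr (l, 0)) f else 0 := by
      intro l
      by_cases hl : l = i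
      · subst hl; simp [partialX_X_mul]; abel
      · simp [partialX_X_mul, hl]
    simp only [h, Finset.sum_add_distrib]
    simp [partialX_X_mul, mul_sub, Finset.mul_sum, smul_add, smul_smul]
    norm_num
    abel

theorem L_euler (i j : Idx m n) (f : SuperPoly m n) :
    L i j (euler m n f) = euler m n (L i j f) := by
  simp only [L_apply, map_sub, map_smul, euler_X_mul, partialXup_euler, mul_add]

/-- The two correction terms are multiples of ∂_{X^i} ∂_{X^j} and ∂_{X^j} ∂_{X^i}; they cancel
because derivatives supercommute. -/
theorem L_laplace (i j : Idx m n) (f : SuperPoly m n) :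
    L i j (laplace m n f) = laplace m n (L i j f) := by
  simp only [L_apply, map_sub, map_smul, laplace_X_mul, partialXup_laplace]
  rw [partialXup_comm i j]
  simp only [smul_add, smul_smul]
  rw [mul_comm (sgn i j) 2]
  abel

/-- `∑_i x_i² - ∑_{j ∈ S} θ_{2j-1} θ_{2j}`. -/
noncomputable def rsq (S : Finset (Fin n)) : SuperPoly m n :=
  (∑ i : Fin m, X (Sum.inl i) * X (Sum.inl i)) - ∑ j ∈ S, X (Sum.inr (j, 0)) * X (Sum.inr (j, 1))

theorem rsq_mul (S : Finset (Fin n)) (f : SuperPoly m n) :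
    rsq S * f = (∑ i : Fin m, X (Sum.inl i) * (X (Sum.inl i) * f)) -
      ∑ j ∈ S, X (Sum.inr (j, 0)) * (X (Sum.inr (j, 1)) * f) := by
  simp only [rsq, sub_mul, Finset.sum_mul, mul_assoc]

theorem Rsq_eq_rsq : Rsq m n = rsq Finset.univ := by
  rw [Rsq, rsq, Fintype.sum_sum_type, Fintype.sum_prod_type, sub_eq_add_neg,
    ← Finset.sum_neg_distrib]
  congr 1
  · refine Finset.sum_congr rfl fun i _ => ?_
    simp [Xup, metric, Matrix.one_apply]
  · refine Finset.sum_congr rfl fun j _ => ?_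
    have h := X_mul_X (m := m) (Sum.inr (j, 1)) (Sum.inr (j, 0))
    simp [Xup, metric, Fintype.sum_prod_type, h]
    module

theorem X_mul_rsq_mul (i : Idx m n) (S : Finset (Fin n)) (f : SuperPoly m n) :
    X i * (rsq S * f) = rsq S * (X i * f) := by
  simp only [rsq_mul, mul_sub, Finset.mul_sum]
  congr 1
  · refine Finset.sum_congr rfl fun j _ => ?_
    rw [X_mul_X_mul i, X_mul_X_mul i]; simp
  · refine Finset.sum_congr rfl fun j _ => ?_
    rw [X_mul_X_mul i, X_mul_X_mul i]
    rcases i with i | a <;> simp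

theorem partialXup_Rsq_mul (i : Idx m n) (f : SuperPoly m n) :
    partialXup i (Rsq m n * f) = Rsq m n * partialXup i f + (2 : ℝ) • (X i * f) := by
  rw [Rsq_eq_rsq, rsq_mul, rsq_mul]
  simp only [map_sub, map_sum]
  induction i using idx_cases with
  | hx i =>
    have h : ∀ l : Fin m, partialXup (Sum.inl i) (X (Sum.inl l) * (X (Sum.inl l) * f)) =
        X (Sum.inl l) * (X (Sum.inl l) * partialXup (Sum.inl i) f) +
          if i = l then (2 : ℝ) • (X (Sum.inl i) * f) else 0 := by
      intro l
      by_cases hl : i = l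
      · subst hl; simp [partialXup_X_mul, two_smul, mul_add]; abel
      · simp [partialXup_X_mul, hl]
    simp only [h, Finset.sum_add_distrib]
    simp [partialXup_X_mul]
    abel
  | h0 i =>
    have h : ∀ l : Fin n, partialXup (Sum.inr (i, 0)) (X (Sum.inr (l, 0)) *
        (X (Sum.inr (l, 1)) * f)) =
        X (Sum.inr (l, 0)) * (X (Sum.inr (l, 1)) * partialXup (Sum.inr (i, 0)) f) -
          if i = l then (2 : ℝ) • (X (Sum.inr (i, 0)) * f) else 0 := by
      intro l
      by_cases hl : i = l
      · subst hl; simp [partialXup_X_mul, mul_add]; abel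
      · simp [partialXup_X_mul, hl]
    simp only [h, Finset.sum_sub_distrib]
    simp [partialXup_X_mul]
    abel
  | h1 i =>
    have h : ∀ l : Fin n, partialXup (Sum.inr (i, 1)) (X (Sum.inr (l, 0)) *
        (X (Sum.inr (l, 1)) * f)) =
        X (Sum.inr (l, 0)) * (X (Sum.inr (l, 1)) * partialXup (Sum.inr (i, 1)) f) -
          if i = l then (2 : ℝ) • (X (Sum.inr (i, 1)) * f) else 0 := by
      intro l
      by_cases hl : i = l
      · subst hl; simp [partialXup_X_mul]; abel
      · simp [partialXup_X_mul, hl]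
    simp only [h, Finset.sum_sub_distrib]
    simp [partialXup_X_mul]
    abel

/-- Dual to the commutation with ∇²: the corrections X_i X_j and X_j X_i cancel by
supercommutativity. -/
theorem L_Rsq_mul (i j : Idx m n) (f : SuperPoly m n) :
    L i j (Rsq m n * f) = Rsq m n * L i j f := by
  simp only [L_apply, partialXup_Rsq_mul, mul_add, mul_sub, mul_smul_comm]
  rw [Rsq_eq_rsq, X_mul_rsq_mul, X_mul_rsq_mul, X_mul_X_mul i j]
  simp only [smul_add]
  rw [smul_comm (2 : ℝ) (sgn i j)]
  abel

theorem euler_rsq_mul (S : Finset (Fin n)) (f : SuperPoly m n) :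
    euler m n (rsq S * f) = rsq S * euler m n f + (2 : ℝ) • (rsq S * f) := by
  simp only [rsq_mul, map_sub, map_sum, euler_X_mul, mul_add, Finset.sum_add_distrib, two_smul]
  abel

theorem L_rsq_pow_mul (i j : Idx m n) (s : ℕ) (f : SuperPoly m n) :
    L i j (Rsq m n ^ s * f) = Rsq m n ^ s * L i j f := by
  induction s with
  | zero => simp
  | succ s ih => rw [pow_succ', mul_assoc, L_Rsq_mul, ih, mul_assoc]

/-! ### Superpolynomials in a part of the variables -/

/-- The superpolynomials in the commuting variables and the pairs of anticommuting variables with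
labels in `S`. -/
noncomputable def varsIn (m : ℕ) (S : Finset (Fin n)) : Submodule ℝ (SuperPoly m n) :=
  ⨅ a : {a : Fin n × Fin 2 // a.1 ∉ S}, LinearMap.ker (partialX (Sum.inr a.1))

theorem mem_varsIn {S : Finset (Fin n)} {f : SuperPoly m n} :
    f ∈ varsIn m S ↔ ∀ a : Fin n × Fin 2, a.1 ∉ S → partialX (Sum.inr a) f = 0 := by
  simp [varsIn, Submodule.mem_iInf]

/-- The labels of the commuting variables and of the pairs in `S`. -/
def Active (S : Finset (Fin n)) : Idx m n → Prop
  | Sum.inl _ => True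
  | Sum.inr a => a.1 ∈ S

@[simp] theorem active_inl (S : Finset (Fin n)) (i : Fin m) :
    Active S (Sum.inl i : Idx m n) := trivial

@[simp] theorem active_inr (S : Finset (Fin n)) (a : Fin n × Fin 2) :
    Active S (Sum.inr a : Idx m n) ↔ a.1 ∈ S := Iff.rfl

@[simp] theorem active_bar (S : Finset (Fin n)) (i : Idx m n) : Active S (bar i) ↔ Active S i := by
  induction i using idx_cases <;> simp

theorem X_mul_mem_varsIn {S : Finset (Fin n)} {i : Idx m n} (hi : Active S i)
    {f : SuperPoly m n} (hf : f ∈ varsIn m S) : X i * f ∈ varsIn m S := by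
  rw [mem_varsIn] at hf ⊢
  intro a ha
  have : (Sum.inr a : Idx m n) ≠ i := by
    rintro rfl; exact ha hi
  rw [partialX_X_mul, hf a ha, if_neg this]; simp

theorem partialX_mem_varsIn {S : Finset (Fin n)} (i : Idx m n)
    {f : SuperPoly m n} (hf : f ∈ varsIn m S) : partialX i f ∈ varsIn m S := by
  rw [mem_varsIn] at hf ⊢
  intro a ha
  rw [partialX_comm, hf a ha]; simp

theorem partialXup_mem_varsIn {S : Finset (Fin n)} (i : Idx m n)
    {f : SuperPoly m n} (hf : f ∈ varsIn m S) : partialXup i f ∈ varsIn m S := by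
  rw [partialXup_apply]
  exact Submodule.smul_mem _ _ (partialX_mem_varsIn _ hf)

theorem laplace_mem_varsIn {S : Finset (Fin n)}
    {f : SuperPoly m n} (hf : f ∈ varsIn m S) : laplace m n f ∈ varsIn m S := by
  rw [mem_varsIn] at hf ⊢
  intro a ha
  rw [partialX_laplace, hf a ha, map_zero]

theorem L_mem_varsIn {S : Finset (Fin n)} {i j : Idx m n} (hi : Active S i) (hj : Active S j)
    {f : SuperPoly m n} (hf : f ∈ varsIn m S) : L i j f ∈ varsIn m S := by
  rw [L_apply]
  exact Submodule.sub_mem _ (X_mul_mem_varsIn hi (partialXup_mem_varsIn _ hf))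
    (Submodule.smul_mem _ _ (X_mul_mem_varsIn hj (partialXup_mem_varsIn _ hf)))

theorem rsq_mul_mem_varsIn {S : Finset (Fin n)}
    {f : SuperPoly m n} (hf : f ∈ varsIn m S) : rsq S * f ∈ varsIn m S := by
  rw [rsq_mul]
  refine Submodule.sub_mem _ (Submodule.sum_mem _ fun i _ => ?_) (Submodule.sum_mem _ fun j hj => ?_)
  · exact X_mul_mem_varsIn (active_inl S i) (X_mul_mem_varsIn (active_inl S i) hf)
  · exact X_mul_mem_varsIn ((active_inr S _).2 hj) (X_mul_mem_varsIn ((active_inr S _).2 hj) hf)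

theorem varsIn_mono {S T : Finset (Fin n)} (h : S ⊆ T) : varsIn m S ≤ varsIn m T := by
  intro f hf
  rw [mem_varsIn] at hf ⊢
  exact fun a ha => hf a fun h' => ha (h h')

theorem varsIn_univ : varsIn m (Finset.univ : Finset (Fin n)) = ⊤ := by
  rw [eq_top_iff]
  intro f _
  simp [mem_varsIn]

theorem one_mem_varsIn (S : Finset (Fin n)) : (1 : SuperPoly m n) ∈ varsIn m S := by
  rw [mem_varsIn]
  exact fun a _ => partialX_one _

theorem euler_eq_of_mem_varsIn {S : Finset (Fin n)} {f : SuperPoly m n} (hf : f ∈ varsIn m S) :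
    euler m n f = (∑ i : Fin m, X (Sum.inl i) * partialX (Sum.inl i) f) +
      ∑ j ∈ S, (X (Sum.inr (j, 0)) * partialX (Sum.inr (j, 0)) f +
        X (Sum.inr (j, 1)) * partialX (Sum.inr (j, 1)) f) := by
  rw [euler_apply, Fintype.sum_sum_type, Fintype.sum_prod_type]
  congr 1
  simp only [Fin.sum_univ_two]
  symm
  refine Finset.sum_subset (Finset.subset_univ S) fun j _ hj => ?_
  rw [mem_varsIn] at hf
  rw [hf (j, 0) hj, hf (j, 1) hj]; simp

/-- The sl₂ relation. Each commuting variable contributes 2f and each pair in S contributes -4f, so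
the constant is twice the superdimension m - 2|S| of the available variables. -/
theorem laplace_rsq_mul {S : Finset (Fin n)} {f : SuperPoly m n} (hf : f ∈ varsIn m S) :
    laplace m n (rsq S * f) = rsq S * laplace m n f + (4 : ℝ) • euler m n f +
      (2 * ((m : ℝ) - 2 * S.card)) • f := by
  rw [rsq_mul, map_sub, map_sum, map_sum, rsq_mul, euler_eq_of_mem_varsIn hf]
  have h1 : ∀ i : Fin m, laplace m n (X (Sum.inl i) * (X (Sum.inl i) * f)) =
      X (Sum.inl i) * (X (Sum.inl i) * laplace m n f) +
        (4 : ℝ) • (X (Sum.inl i) * partialX (Sum.inl i) f) + (2 : ℝ) • f := by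
    intro i
    simp [laplace_X_mul, partialXup_apply, partialX_X_mul, mul_add, smul_add]
    module
  have h2 : ∀ j : Fin n, laplace m n (X (Sum.inr (j, 0)) * (X (Sum.inr (j, 1)) * f)) =
      X (Sum.inr (j, 0)) * (X (Sum.inr (j, 1)) * laplace m n f) -
        (4 : ℝ) • (X (Sum.inr (j, 0)) * partialX (Sum.inr (j, 0)) f +
        X (Sum.inr (j, 1)) * partialX (Sum.inr (j, 1)) f) + (4 : ℝ) • f := by
    intro j
    simp [laplace_X_mul, partialXup_apply, partialX_X_mul, mul_add, smul_add]
    module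
  simp only [h1, h2, Finset.sum_add_distrib, Finset.sum_sub_distrib, ← Finset.smul_sum,
    Finset.sum_const, Finset.card_univ, Fintype.card_fin]
  rw [← Nat.cast_smul_eq_nsmul ℝ, ← Nat.cast_smul_eq_nsmul ℝ]
  module

/-! ### The bilinear form -/

/-- The bilinear form on polynomials for which the monomials are orthogonal and
`⟨x^α, x^α⟩ = α!`. -/
noncomputable def polyForm (m : ℕ) :
    MvPolynomial (Fin m) ℝ →ₗ[ℝ] MvPolynomial (Fin m) ℝ →ₗ[ℝ] ℝ :=
  (MvPolynomial.basisMonomials (Fin m) ℝ).constr ℝ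
    fun α => (∏ i, ((α i).factorial : ℝ)) • MvPolynomial.lcoeff ℝ α

theorem polyForm_monomial (α : Fin m →₀ ℕ) (c : ℝ) (q : MvPolynomial (Fin m) ℝ) :
    polyForm m (MvPolynomial.monomial α c) q =
      c * (∏ i, ((α i).factorial : ℝ)) * MvPolynomial.coeff α q := by
  have : MvPolynomial.monomial α c = c • MvPolynomial.basisMonomials (Fin m) ℝ α := by
    simp [MvPolynomial.smul_monomial]
  rw [this, map_smul, polyForm, Module.Basis.constr_basis]
  simp [mul_assoc]

/-- The factorials in the form absorb the exponent produced by differentiation: (α + e_i)! = (α_i +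
1) α!. -/
theorem polyForm_X_mul (i : Fin m) (p q : MvPolynomial (Fin m) ℝ) :
    polyForm m (MvPolynomial.X i * p) q = polyForm m p (MvPolynomial.pderiv i q) := by
  induction p using MvPolynomial.induction_on' with
  | add p₁ p₂ h₁ h₂ => simp only [mul_add, map_add, LinearMap.add_apply, h₁, h₂]
  | monomial α c =>
    rw [MvPolynomial.X, MvPolynomial.monomial_mul, one_mul, polyForm_monomial, polyForm_monomial,
      MvPolynomial.coeff_pderiv, add_comm (Finsupp.single i 1) α]
    have : (∏ j, (((α + Finsupp.single i 1 : Fin m →₀ ℕ) j).factorial : ℝ)) =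
        (∏ j, ((α j).factorial : ℝ)) * (α i + 1) := by
      rw [← Finset.mul_prod_erase _ _ (Finset.mem_univ i),
        ← Finset.mul_prod_erase (a := i) (s := Finset.univ) (f := fun j => ((α j).factorial : ℝ))
          (Finset.mem_univ i)]
      have : ∀ j ∈ Finset.univ.erase i, (((α + Finsupp.single i 1 : Fin m →₀ ℕ) j).factorial : ℝ) =
          (α j).factorial := by
        intro j hj
        rw [Finsupp.add_apply, Finsupp.single_eq_of_ne (Finset.ne_of_mem_erase hj), add_zero]
      rw [Finset.prod_congr rfl this, Finsupp.add_apply, Finsupp.single_eq_same,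
        Nat.factorial_succ]
      push_cast
      ring
    rw [this]
    ring

theorem polyForm_comm (p q : MvPolynomial (Fin m) ℝ) : polyForm m p q = polyForm m q p := by
  induction p using MvPolynomial.induction_on' with
  | add p₁ p₂ h₁ h₂ => simp only [map_add, LinearMap.add_apply, h₁, h₂]
  | monomial α c =>
    induction q using MvPolynomial.induction_on' with
    | add p₁ p₂ h₁ h₂ => simp only [map_add, LinearMap.add_apply, h₁, h₂]
    | monomial β d =>
      rw [polyForm_monomial, polyForm_monomial, MvPolynomial.coeff_monomial,
        MvPolynomial.coeff_monomial]
      by_cases h : α = β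
      · subst h; simp; ring
      · simp [h, Ne.symm h]

theorem polyForm_self (p : MvPolynomial (Fin m) ℝ) :
    polyForm m p p = ∑ α ∈ p.support, (∏ i, ((α i).factorial : ℝ)) * (p.coeff α) ^ 2 := by
  have h : ∀ q, polyForm m p q =
      ∑ α ∈ p.support, (∏ i, ((α i).factorial : ℝ)) * (p.coeff α * q.coeff α) := by
    intro q
    conv_lhs => rw [← MvPolynomial.support_sum_monomial_coeff p]
    rw [map_sum, LinearMap.sum_apply]
    refine Finset.sum_congr rfl fun α _ => ?_
    rw [polyForm_monomial]
    ring
  rw [h]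
  simp only [sq]

theorem polyForm_self_pos {p : MvPolynomial (Fin m) ℝ} (hp : p ≠ 0) : 0 < polyForm m p p := by
  rw [polyForm_self]
  refine Finset.sum_pos (fun α hα => ?_) (MvPolynomial.support_nonempty.2 hp)
  have : p.coeff α ≠ 0 := MvPolynomial.mem_support_iff.1 hα
  positivity

/-- The scalar `lam` as a function on the labels of anticommuting variables. -/
noncomputable def lamOdd (a : Fin n × Fin 2) : ℝ := lam (m := 0) (Sum.inr a)

/-- Vectors as scaled covectors. -/
noncomputable def oddDual (n : ℕ) :
    (Fin n × Fin 2 → ℝ) →ₗ[ℝ] Module.Dual ℝ (Fin n × Fin 2 → ℝ) :=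
  (Pi.basisFun ℝ (Fin n × Fin 2)).constr ℝ fun a => lamOdd a • LinearMap.proj a

/-- The anti-homomorphism sending `θ_a` to a multiple of the operator `∂_{θ_a}`. -/
noncomputable def grassmannStar (n : ℕ) :
    Grassmann n →ₐ[ℝ] (Module.End ℝ (Grassmann n))ᵐᵒᵖ :=
  ExteriorAlgebra.lift ℝ
    -- The opposite algebra accounts for adjoints reversing products; the extension from vectors
    -- only requires that contractions square to zero.
    ⟨(MulOpposite.opLinearEquiv ℝ).toLinearMap ∘ₗ
      (CliffordAlgebra.contractLeft (Q := (0 : QuadraticForm ℝ (Fin n × Fin 2 → ℝ)))) ∘ₗ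
        oddDual n, fun v => by
      apply MulOpposite.unop_injective
      refine LinearMap.ext fun w => ?_
      exact CliffordAlgebra.contractLeft_contractLeft
        (Q := (0 : QuadraticForm ℝ (Fin n × Fin 2 → ℝ))) _ w⟩

/-- The bilinear form on the Grassmann algebra for which left multiplication by `θ_a` is adjoint to
`lamOdd a • ∂_{θ_a}`. -/
noncomputable def grassmannForm (n : ℕ) : Grassmann n →ₗ[ℝ] Grassmann n →ₗ[ℝ] ℝ :=
  LinearMap.compr₂ ((MulOpposite.opLinearEquiv ℝ).symm.toLinearMap ∘ₗ
    (grassmannStar n).toLinearMap) ExteriorAlgebra.algebraMapInv.toLinearMap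

theorem grassmannForm_apply (w v : Grassmann n) :
    grassmannForm n w v = ExteriorAlgebra.algebraMapInv ((grassmannStar n w).unop v) := rfl

theorem grassmannForm_th_mul (a : Fin n × Fin 2) (w v : Grassmann n) :
    grassmannForm n (th a * w) v = lamOdd a * grassmannForm n w (dth a v) := by
  have h : grassmannStar n (th a) = MulOpposite.op (lamOdd a • dth a) := by
    rw [grassmannStar, th, ExteriorAlgebra.lift_ι_apply]
    have : oddDual n (Pi.single a 1) = lamOdd a • LinearMap.proj a := by
      rw [oddDual, ← Pi.basisFun_apply, Module.Basis.constr_basis]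
    simp only [LinearMap.comp_apply, this, map_smul]
    rfl
  rw [grassmannForm_apply, map_mul, h, grassmannForm_apply]
  simp

theorem grassmannForm_one (v : Grassmann n) :
    grassmannForm n 1 v = ExteriorAlgebra.algebraMapInv v := by
  rw [grassmannForm_apply, map_one]; rfl

/-- The bilinear form on superpolynomials for which multiplication by `X_i` is adjoint to
`lam i • ∂_{X_i}`. -/
noncomputable def form (m n : ℕ) : SuperPoly m n →ₗ[ℝ] SuperPoly m n →ₗ[ℝ] ℝ :=
  LinearMap.compr₂ (TensorProduct.map₂ (polyForm m) (grassmannForm n))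
    (TensorProduct.lid ℝ ℝ).toLinearMap

theorem form_tm (p q : MvPolynomial (Fin m) ℝ) (w v : Grassmann n) :
    form m n (tm p w) (tm q v) = polyForm m p q * grassmannForm n w v := rfl

theorem form_X_mul (i : Idx m n) (f g : SuperPoly m n) :
    form m n (X i * f) g = lam i * form m n f (partialX i g) := by
  induction f using tm_induction with
  | h0 => simp
  | ha f₁ f₂ h₁ h₂ => simp only [mul_add, map_add, LinearMap.add_apply, h₁, h₂]
  | ht p w =>
    induction g using tm_induction with
    | h0 => simp
    | ha f₁ f₂ h₁ h₂ => simp only [mul_add, map_add, h₁, h₂]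
    | ht q v =>
      rcases i with i | a
      · rw [X_inl, tm_mul, one_mul, partialX_inl_tm, form_tm, form_tm, polyForm_X_mul, lam_inl,
          one_mul]
      · rw [X_inr, tm_mul, one_mul, partialX_inr_tm, form_tm, form_tm, grassmannForm_th_mul]
        have : lamOdd a = lam (m := m) (Sum.inr a) := rfl
        rw [this]; ring

theorem polyForm_one (q : MvPolynomial (Fin m) ℝ) :
    polyForm m 1 q = MvPolynomial.coeff 0 q := by
  have := polyForm_monomial (m := m) 0 1 q
  simpa using this

theorem form_one_one : form m n 1 1 = 1 := by
  rw [← tm_one, form_tm, polyForm_one, grassmannForm_one]; simp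

theorem form_one_X_mul (i : Idx m n) (g : SuperPoly m n) : form m n 1 (X i * g) = 0 := by
  induction g using tm_induction with
  | h0 => simp
  | ha f₁ f₂ h₁ h₂ => rw [mul_add, map_add, h₁, h₂, add_zero]
  | ht q v =>
    rw [← tm_one]
    rcases i with i | a
    · rw [X_inl, tm_mul, form_tm, polyForm_one, mul_comm, mul_eq_zero]; right; simp [MvPolynomial.coeff_X_mul']
    · rw [X_inr, tm_mul, form_tm, grassmannForm_one, map_mul ExteriorAlgebra.algebraMapInv, th,
        ExteriorAlgebra.algebraMapInv]
      simp

/-- The other half of adjointness, obtained before symmetry is known and used to prove it. On f = 1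
both sides vanish, since X_i g has no constant term; the induction step works because X_i and
∂_{X_i} satisfy a relation that is unchanged by taking adjoints. -/
theorem form_partialX (i : Idx m n) (f g : SuperPoly m n) :
    lam i * form m n (partialX i f) g = form m n f (X i * g) := by
  induction f using superPoly_induction generalizing g with
  | h1 => rw [partialX_one, form_one_X_mul]; simp
  | hs c f hf =>
    simp only [map_smul, LinearMap.smul_apply, smul_eq_mul, ← hf]; ring
  | ha f₁ f₂ h₁ h₂ => simp only [map_add, LinearMap.add_apply, mul_add, h₁, h₂]
  | hX j f hf =>
    rw [partialX_X_mul, form_X_mul, partialX_X_mul, map_add, LinearMap.add_apply, map_smul,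
      LinearMap.smul_apply, smul_eq_mul, form_X_mul, map_add, map_smul, smul_eq_mul, ← hf,
      sgn_comm j i]
    by_cases h : i = j
    · subst h; simp [mul_add]
    · simp [h, Ne.symm h]; ring

theorem form_comm (f g : SuperPoly m n) : form m n f g = form m n g f := by
  induction f using superPoly_induction generalizing g with
  | h1 =>
    induction g using superPoly_induction with
    | h1 => rfl
    | hs c f hf => simp only [map_smul, LinearMap.smul_apply, smul_eq_mul, hf]
    | ha f₁ f₂ h₁ h₂ => simp only [map_add, LinearMap.add_apply, h₁, h₂]
    | hX j f hf => rw [form_one_X_mul, form_X_mul, partialX_one]; simp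
  | hs c f hf => simp only [map_smul, LinearMap.smul_apply, smul_eq_mul, hf]
  | ha f₁ f₂ h₁ h₂ => simp only [map_add, LinearMap.add_apply, h₁, h₂]
  | hX j f hf => rw [form_X_mul, hf, form_partialX]

theorem form_X_mul_partialXup (i j : Idx m n) (f g : SuperPoly m n) :
    form m n (X i * partialXup j f) g =
      (lam i / lam (bar i)) * (lam j / lam (bar j)) *
        form m n f (X (bar j) * partialXup (bar i) g) := by
  rw [form_X_mul, partialXup_apply, partialXup_apply, map_smul (form m n), LinearMap.smul_apply,
    mul_smul_comm, mul_smul_comm, map_smul (form m n f), bar_bar, ← form_partialX]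
  have h1 := lam_ne_zero i
  have h2 := lam_ne_zero j
  have h3 := lam_ne_zero (bar i)
  have h4 := lam_ne_zero (bar j)
  simp only [smul_eq_mul]
  field_simp

theorem form_L (i j : Idx m n) (f g : SuperPoly m n) :
    form m n (L i j f) g = -(sgn i j * (lam i / lam (bar i)) * (lam j / lam (bar j))) *
      form m n f (L (bar i) (bar j) g) := by
  rw [L_apply, L_apply, map_sub, LinearMap.sub_apply, map_smul, LinearMap.smul_apply,
    form_X_mul_partialXup, form_X_mul_partialXup, map_sub, map_smul, smul_eq_mul, smul_eq_mul,
    sgn_bar_left, sgn_bar_right]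
  have h := sgn_mul_self i j
  linear_combination (form m n f (X (bar j) * partialXup (bar i) g) *
    (lam i / lam (bar i)) * (lam j / lam (bar j))) * (-h)

/-- The constants 2 and -2 in `lam` are made for this: θ_0 θ_1 has adjoint -4 ∂_{θ_1} ∂_{θ_0} = 4
∂_{θ_0} ∂_{θ_1}, matching the coefficient in ∇². Consequently multiples of R² are orthogonal to
harmonics. -/
theorem form_rsq_mul {S : Finset (Fin n)} (f : SuperPoly m n) {g : SuperPoly m n}
    (hg : g ∈ varsIn m S) : form m n (rsq S * f) g = form m n f (laplace m n g) := by
  rw [rsq_mul, laplace_apply, ← Finset.sum_subset (Finset.subset_univ S)]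
  · simp only [map_sub, map_sum, LinearMap.sub_apply, LinearMap.sum_apply, map_smul, smul_eq_mul,
      Finset.mul_sum, form_X_mul, lam_inl, one_mul, lam_inr_zero, lam_inr_one]
    congr 1
    refine Finset.sum_congr rfl fun j _ => ?_
    rw [partialX_comm (Sum.inr (j, 1)), map_smul, sgn_inr, smul_eq_mul]
    ring
  · intro j _ hj
    rw [mem_varsIn] at hg
    rw [hg (j, 1) hj, map_zero]

/-! ### Eigenvectors of the Euler operator -/

/-- If a vector space is spanned by the intersections of the eigenspaces of `E` with given
subspaces, then each eigenspace is contained in its subspace. -/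
theorem eigenspace_le_of_iSup_eq_top {V : Type*} [AddCommGroup V] [Module ℝ V]
    (E : Module.End ℝ V) (G : ℝ → Submodule ℝ V) (h : ⨆ c, E.eigenspace c ⊓ G c = ⊤) (c : ℝ) :
    E.eigenspace c ≤ G c := by
  classical
  intro f hf
  have hmem : f ∈ ⨆ c, E.eigenspace c ⊓ G c := h ▸ Submodule.mem_top
  rw [Submodule.mem_iSup_iff_exists_finsupp] at hmem
  obtain ⟨t, ht, hsum⟩ := hmem
  have hind := (iSupIndep_iff_finsetSum_eq_imp_eq (p := E.eigenspace)).1 E.eigenspaces_iSupIndep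
  have hs : ∑ i ∈ insert c t.support, (Pi.single c f : ℝ → V) i = f := by
    rw [Finset.sum_eq_single_of_mem c (Finset.mem_insert_self _ _)
      (fun x _ hx => Pi.single_eq_of_ne hx _), Pi.single_eq_same]
  have := hind (insert c t.support) t (Pi.single c f)
    (fun i _ => ⟨(ht i).1, by
      by_cases hi : i = c
      · subst hi; simpa using hf
      · simp [hi]⟩) (by
      rw [hs, ← hsum, Finsupp.sum]
      symm
      refine Finset.sum_subset (Finset.subset_insert _ _) fun x _ hx => ?_
      simpa using hx) c (Finset.mem_insert_self _ _)
  rw [Pi.single_eq_same] at this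
  exact this ▸ (ht c).2

/-- The grading by degree, in the weak form needed: no negative degrees, and only constants in
degree 0. Multiplication by X_i raises the eigenvalue by one, so the span of eigenvectors satisfying
the bound contains 1 and is closed under the variables. -/
theorem euler_eigenspace_le (c : ℝ) : (euler m n).eigenspace c ≤
    if c < 0 then ⊥ else if c = 0 then Submodule.span ℝ {1} else ⊤ := by
  refine eigenspace_le_of_iSup_eq_top (euler m n)
    (fun c => if c < 0 then ⊥ else if c = 0 then Submodule.span ℝ {1} else ⊤) ?_ c
  refine eq_top_of_X_mul_mem _ (Submodule.mem_iSup_of_mem (0 : ℝ) ⟨?_, ?_⟩) fun i => ?_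
  · rw [SetLike.mem_coe, Module.End.mem_eigenspace_iff, euler_apply]; simp [partialX_one]
  · simp
  · suffices (⨆ c, (euler m n).eigenspace c ⊓
        if c < 0 then ⊥ else if c = 0 then Submodule.span ℝ {1} else ⊤) ≤
      (⨆ c, (euler m n).eigenspace c ⊓ if c < 0 then ⊥ else
        if c = 0 then Submodule.span ℝ {1} else ⊤).comap (LinearMap.mulLeft ℝ (X i)) from
      fun f hf => this hf
    refine iSup_le fun c => ?_
    rintro f ⟨h1, h2⟩
    refine Submodule.mem_iSup_of_mem (c + 1) ⟨?_, ?_⟩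
    · rw [SetLike.mem_coe, Module.End.mem_eigenspace_iff] at h1
      rw [SetLike.mem_coe, Module.End.mem_eigenspace_iff, LinearMap.mulLeft_apply, euler_X_mul, h1, add_smul,
        one_smul, mul_smul_comm]
    · by_cases hc : c < 0
      · simp only [hc, if_true, SetLike.mem_coe, Submodule.mem_bot] at h2
        simp [h2]
      · have h3 : ¬ c + 1 < 0 := by linarith
        have h4 : ¬ c + 1 = 0 := by linarith
        simp [h3, h4]

theorem eq_zero_of_euler_neg {f : SuperPoly m n} {c : ℝ} (hc : c < 0)
    (hf : euler m n f = c • f) : f = 0 := by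
  have := euler_eigenspace_le c (Module.End.mem_eigenspace_iff.2 hf)
  simpa [hc] using this

theorem exists_smul_one_of_euler_zero {f : SuperPoly m n} (hf : euler m n f = 0) :
    ∃ r : ℝ, f = r • 1 := by
  have := euler_eigenspace_le (0 : ℝ) (Module.End.mem_eigenspace_iff.2 (by simpa using hf))
  simp only [lt_irrefl, if_false, if_true, Submodule.mem_span_singleton] at this
  obtain ⟨r, hr⟩ := this
  exact ⟨r, hr.symm⟩

theorem mem_homog {k : ℕ} {f : SuperPoly m n} : f ∈ homog m n k ↔ euler m n f = (k : ℝ) • f := by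
  simp [homog, sub_eq_zero]

theorem euler_partialX {f : SuperPoly m n} {c : ℝ} (hf : euler m n f = c • f) (i : Idx m n) :
    euler m n (partialX i f) = (c - 1) • partialX i f := by
  have := partialX_euler i f
  rw [hf, map_smul] at this
  rw [sub_smul, one_smul, this]; abel

/-- Euler's relation (k+1) f = ∑ X_i ∂_{X_i} f writes degree k + 1 as a finite sum of images of
degree k. -/
theorem finiteDimensional_homog (k : ℕ) : FiniteDimensional ℝ (homog m n k) := by
  induction k with
  | zero =>
    have : homog m n 0 ≤ Submodule.span ℝ {1} := by
      intro f hf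
      rw [mem_homog] at hf
      obtain ⟨r, rfl⟩ := exists_smul_one_of_euler_zero (by simpa using hf)
      exact Submodule.smul_mem _ _ (Submodule.mem_span_singleton_self _)
    exact Submodule.finiteDimensional_of_le this
  | succ k ih =>
    have : homog m n (k + 1) ≤ ⨆ i, (homog m n k).map (LinearMap.mulLeft ℝ (X i)) := by
      intro f hf
      rw [mem_homog] at hf
      have h1 : f = ((k + 1 : ℕ) : ℝ)⁻¹ • euler m n f := by
        rw [hf, smul_smul, inv_mul_cancel₀ (by positivity), one_smul]
      rw [h1, euler_apply]
      refine Submodule.smul_mem _ _ (Submodule.sum_mem _ fun i _ =>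
        Submodule.mem_iSup_of_mem i ⟨partialX i f, ?_, rfl⟩)
      rw [SetLike.mem_coe, mem_homog, euler_partialX hf]
      push_cast; simp
    exact Submodule.finiteDimensional_of_le this

/-- Superpolynomials without anticommuting variables, as the image of the polynomials. -/
noncomputable def polyIncl (m n : ℕ) : MvPolynomial (Fin m) ℝ →ₗ[ℝ] SuperPoly m n where
  toFun p := tm p 1
  map_add' p q := tm_add_left p q 1
  map_smul' c p := tm_smul_left c p 1

theorem polyIncl_apply (p : MvPolynomial (Fin m) ℝ) : polyIncl m n p = tm p 1 := rfl

theorem X_inl_mul_polyIncl (i : Fin m) (p : MvPolynomial (Fin m) ℝ) :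
    X (Sum.inl i) * polyIncl m n p = polyIncl m n (MvPolynomial.X i * p) := by
  rw [polyIncl_apply, polyIncl_apply, X_inl, tm_mul, one_mul]

theorem partialX_inl_polyIncl (i : Fin m) (p : MvPolynomial (Fin m) ℝ) :
    partialX (Sum.inl i) (polyIncl m n p) = polyIncl m n (MvPolynomial.pderiv i p) := rfl

theorem partialX_inr_polyIncl (a : Fin n × Fin 2) (p : MvPolynomial (Fin m) ℝ) :
    partialX (Sum.inr a) (polyIncl m n p) = 0 := by
  rw [polyIncl_apply, partialX_inr_tm, ← map_one (algebraMap ℝ (Grassmann n)), dth_algebraMap,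
    tm_zero_right]

/-- The part of the Euler operator in the anticommuting variables. -/
noncomputable def oddEuler (m n : ℕ) : Module.End ℝ (SuperPoly m n) :=
  ∑ a, mulOp (X (Sum.inr a)) * partialX (Sum.inr a)

theorem oddEuler_apply (f : SuperPoly m n) :
    oddEuler m n f = ∑ a, X (Sum.inr a) * partialX (Sum.inr a) f := by
  simp [oddEuler, mulOp]

theorem oddEuler_X_inl_mul (i : Fin m) (f : SuperPoly m n) :
    oddEuler m n (X (Sum.inl i) * f) = X (Sum.inl i) * oddEuler m n f := by
  rw [oddEuler_apply, oddEuler_apply, Finset.mul_sum]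
  refine Finset.sum_congr rfl fun a _ => ?_
  rw [partialX_X_mul, X_mul_X_mul (Sum.inl i)]; simp

theorem oddEuler_X_inr_mul (b : Fin n × Fin 2) (f : SuperPoly m n) :
    oddEuler m n (X (Sum.inr b) * f) =
      X (Sum.inr b) * oddEuler m n f + X (Sum.inr b) * f := by
  rw [oddEuler_apply, oddEuler_apply, Finset.mul_sum]
  have : ∀ a : Fin n × Fin 2, X (Sum.inr a) * partialX (Sum.inr a) (X (Sum.inr b) * f) =
      X (Sum.inr b) * (X (Sum.inr a) * partialX (Sum.inr a) f) +
        if a = b then X (Sum.inr b) * f else 0 := by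
    intro a
    rw [partialX_X_mul, X_mul_X_mul (Sum.inr b)]
    by_cases h : a = b
    · subst h; simp [mul_add]; abel
    · simp [h]
  simp only [this, Finset.sum_add_distrib, Finset.sum_ite_eq', Finset.mem_univ, if_true]

/-- The same argument for the degree in the θ's alone; degree 0 then means an ordinary polynomial.
-/
theorem oddEuler_eigenspace_le (c : ℝ) : (oddEuler m n).eigenspace c ≤
    if c < 0 then ⊥ else if c = 0 then LinearMap.range (polyIncl m n) else ⊤ := by
  refine eigenspace_le_of_iSup_eq_top (oddEuler m n)
    (fun c => if c < 0 then ⊥ else if c = 0 then LinearMap.range (polyIncl m n) else ⊤) ?_ c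
  refine eq_top_of_X_mul_mem _ (Submodule.mem_iSup_of_mem (0 : ℝ) ⟨?_, ?_⟩) fun i => ?_
  · rw [SetLike.mem_coe, Module.End.mem_eigenspace_iff, oddEuler_apply]; simp [partialX_one]
  · simp only [lt_irrefl, if_false, if_true]
    exact ⟨1, tm_one⟩
  · suffices (⨆ c, (oddEuler m n).eigenspace c ⊓
        if c < 0 then ⊥ else if c = 0 then LinearMap.range (polyIncl m n) else ⊤) ≤
      (⨆ c, (oddEuler m n).eigenspace c ⊓ if c < 0 then ⊥ else
        if c = 0 then LinearMap.range (polyIncl m n) else ⊤).comap (LinearMap.mulLeft ℝ (X i)) from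
      fun f hf => this hf
    refine iSup_le fun c => ?_
    rintro f ⟨h1, h2⟩
    rw [SetLike.mem_coe, Module.End.mem_eigenspace_iff] at h1
    rcases i with i | b
    · refine Submodule.mem_iSup_of_mem c ⟨?_, ?_⟩
      · rw [SetLike.mem_coe, Module.End.mem_eigenspace_iff, LinearMap.mulLeft_apply,
          oddEuler_X_inl_mul, h1, mul_smul_comm]
      · by_cases hc : c < 0
        · simp only [hc, if_true, SetLike.mem_coe, Submodule.mem_bot] at h2
          simp [h2]
        · by_cases h0 : c = 0
          · subst h0
            simp only [lt_irrefl, if_false, if_true] at h2 ⊢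
            obtain ⟨p, rfl⟩ := h2
            exact ⟨MvPolynomial.X i * p, (X_inl_mul_polyIncl i p).symm⟩
          · simp [hc, h0]
    · refine Submodule.mem_iSup_of_mem (c + 1) ⟨?_, ?_⟩
      · rw [SetLike.mem_coe, Module.End.mem_eigenspace_iff, LinearMap.mulLeft_apply,
          oddEuler_X_inr_mul, h1, add_smul, one_smul, mul_smul_comm]
      · by_cases hc : c < 0
        · simp only [hc, if_true, SetLike.mem_coe, Submodule.mem_bot] at h2
          simp [h2]
        · have h3 : ¬ c + 1 < 0 := by linarith
          have h4 : ¬ c + 1 = 0 := by linarith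
          simp [h3, h4]

theorem exists_polyIncl_eq {f : SuperPoly m n} (hf : f ∈ varsIn m (∅ : Finset (Fin n))) :
    ∃ p, polyIncl m n p = f := by
  have h : oddEuler m n f = 0 := by
    rw [oddEuler_apply]
    refine Finset.sum_eq_zero fun a _ => ?_
    rw [mem_varsIn.1 hf a (Finset.notMem_empty _), mul_zero]
  have := oddEuler_eigenspace_le (0 : ℝ) (Module.End.mem_eigenspace_iff.2 (by simpa using h))
  simpa using this

theorem form_polyIncl (p q : MvPolynomial (Fin m) ℝ) :
    form m n (polyIncl m n p) (polyIncl m n q) = polyForm m p q := by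
  rw [polyIncl_apply, polyIncl_apply, form_tm, grassmannForm_one, map_one, mul_one]

theorem polyIncl_injective : Function.Injective (polyIncl m n) := by
  rw [injective_iff_map_eq_zero]
  intro p hp
  by_contra h
  have := polyForm_self_pos h
  rw [← form_polyIncl (n := n), hp] at this
  simp at this

theorem form_self_pos {f : SuperPoly m n} (hf : f ∈ varsIn m (∅ : Finset (Fin n))) (h0 : f ≠ 0) :
    0 < form m n f f := by
  obtain ⟨p, rfl⟩ := exists_polyIncl_eq hf
  rw [form_polyIncl]
  exact polyForm_self_pos (by rintro rfl; simp at h0)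

/-! ### Classical spherical harmonics -/

open MvPolynomial in
/-- The rotation operator `x_i ∂_j - x_j ∂_i` on polynomials. -/
noncomputable def rot (i j : Fin m) :
    MvPolynomial (Fin m) ℝ →ₗ[ℝ] MvPolynomial (Fin m) ℝ :=
  LinearMap.mulLeft ℝ (MvPolynomial.X i) ∘ₗ (pderiv j).toLinearMap -
    LinearMap.mulLeft ℝ (MvPolynomial.X j) ∘ₗ (pderiv i).toLinearMap

theorem rot_apply (i j : Fin m) (p : MvPolynomial (Fin m) ℝ) :
    rot i j p = MvPolynomial.X i * MvPolynomial.pderiv j p -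
      MvPolynomial.X j * MvPolynomial.pderiv i p := rfl

theorem polyForm_rot (i j : Fin m) (p q : MvPolynomial (Fin m) ℝ) :
    polyForm m (rot i j p) q = -polyForm m p (rot i j q) := by
  rw [rot_apply, rot_apply, map_sub, LinearMap.sub_apply, polyForm_X_mul, polyForm_X_mul, map_sub,
    polyForm_comm p, polyForm_comm p, polyForm_X_mul, polyForm_X_mul,
    polyForm_comm (MvPolynomial.pderiv j p), polyForm_comm (MvPolynomial.pderiv i p)]
  ring

/-- Homogeneous harmonic polynomials of degree `k`. -/
noncomputable def polyHarm (m k : ℕ) : Submodule ℝ (MvPolynomial (Fin m) ℝ) :=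
  MvPolynomial.homogeneousSubmodule (Fin m) ℝ k ⊓
    LinearMap.ker (∑ i : Fin m, (MvPolynomial.pderiv (R := ℝ) i).toLinearMap ∘ₗ
      (MvPolynomial.pderiv i).toLinearMap)

theorem mem_polyHarm {k : ℕ} {p : MvPolynomial (Fin m) ℝ} : p ∈ polyHarm m k ↔
    p.IsHomogeneous k ∧ ∑ i, MvPolynomial.pderiv i (MvPolynomial.pderiv i p) = 0 := by
  simp [polyHarm]

theorem coeff_X_mul_pderiv_self (i : Fin m) (p : MvPolynomial (Fin m) ℝ) (α : Fin m →₀ ℕ) :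
    (MvPolynomial.X i * MvPolynomial.pderiv i p).coeff α = α i * p.coeff α := by
  rw [MvPolynomial.coeff_X_mul']
  split_ifs with h
  · have h1 : 1 ≤ α i := Nat.one_le_iff_ne_zero.2 (Finsupp.mem_support_iff.1 h)
    rw [MvPolynomial.coeff_pderiv, tsub_add_cancel_of_le (Finsupp.single_le_iff.2 h1)]
    simp [Nat.cast_sub h1, mul_comm]
  · rw [Finsupp.notMem_support_iff.1 h]; simp

theorem eq_single_of_degree_eq {k : ℕ} {o : Fin m} {α : Fin m →₀ ℕ} (hd : α.degree = k)
    (ho : α o = k) : α = Finsupp.single o k := by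
  have hsum : α o + ∑ i ∈ Finset.univ.erase o, α i = k := by
    rw [← hd, Finsupp.degree_eq_sum, ← Finset.add_sum_erase _ _ (Finset.mem_univ o)]
  ext j
  by_cases hj : j = o
  · subst hj; simpa using ho
  · rw [Finsupp.single_eq_of_ne hj]
    have : ∑ i ∈ Finset.univ.erase o, α i = 0 := by omega
    exact Finset.sum_eq_zero_iff.1 this j (Finset.mem_erase.2 ⟨hj, Finset.mem_univ j⟩)

/-- Rotations x_o ∂_j - x_j ∂_o move any monomial towards x_o^k, so the coefficient at x_o^k detects
nonzero stable spaces. The induction is on r, the degree in the variables other than x_o. -/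
theorem eq_bot_of_coeff_eq_zero {k : ℕ} (o : Fin m) {W : Submodule ℝ (MvPolynomial (Fin m) ℝ)}
    (hW : W ≤ polyHarm m k) (hst : ∀ i j, ∀ p ∈ W, rot i j p ∈ W)
    (h0 : ∀ p ∈ W, p.coeff (Finsupp.single o k) = 0) : W = ⊥ := by
  have key : ∀ r : ℕ, ∀ p ∈ W, ∀ α : Fin m →₀ ℕ, α.degree = k → α o + r = k →
      p.coeff α = 0 := by
    intro r
    induction r using Nat.strong_induction_on with
    | _ r ih =>
      intro p hp α hd hr
      have hsum : ∑ i, α i = k := by rw [← hd, Finsupp.degree_eq_sum]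
      rw [← Finset.add_sum_erase _ _ (Finset.mem_univ o)] at hsum
      rcases Nat.eq_zero_or_pos r with rfl | hr0
      · rw [eq_single_of_degree_eq hd hr]
        exact h0 p hp
      · have : ∑ i ∈ Finset.univ.erase o, α i ≠ 0 := by omega
        obtain ⟨j, hj, hαj⟩ := Finset.exists_ne_zero_of_sum_ne_zero this
        have hjo : j ≠ o := Finset.ne_of_mem_erase hj
        obtain ⟨γ, rfl⟩ : ∃ γ : Fin m →₀ ℕ, α = γ + Finsupp.single j 1 :=
          ⟨α - Finsupp.single j 1, (tsub_add_cancel_of_le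
            (Finsupp.single_le_iff.2 (Nat.one_le_iff_ne_zero.2 hαj))).symm⟩
        have hγo : γ o + r = k := by simpa [Finsupp.single_eq_of_ne hjo.symm] using hr
        have hγd : γ.degree + 1 = k := by simpa using hd
        -- In the rotated polynomial this coefficient is (γ_j + 1) times the wanted one, minus a
        -- term from x_j ∂_o whose monomial has x_o-exponent two higher than the wanted one and is
        -- covered by the case r - 2.
        have h1 := ih (r - 1) (by omega) _ (hst o j p hp) (Finsupp.single o 1 + γ)
          (by simp; omega) (by simp; omega)
        rw [rot_apply, MvPolynomial.coeff_sub, MvPolynomial.coeff_X_mul,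
          MvPolynomial.coeff_pderiv, MvPolynomial.coeff_X_mul'] at h1
        have h2 : (if j ∈ (Finsupp.single o 1 + γ).support then
            (MvPolynomial.pderiv o p).coeff (Finsupp.single o 1 + γ - Finsupp.single j 1)
            else 0) = 0 := by
          split_ifs with hmem
          · rw [Finsupp.mem_support_iff, Finsupp.add_apply, Finsupp.single_eq_of_ne hjo,
              zero_add] at hmem
            obtain ⟨δ, rfl⟩ : ∃ δ : Fin m →₀ ℕ, γ = δ + Finsupp.single j 1 :=
              ⟨γ - Finsupp.single j 1, (tsub_add_cancel_of_le
                (Finsupp.single_le_iff.2 (Nat.one_le_iff_ne_zero.2 hmem))).symm⟩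
            have hδo : δ o + r = k := by simpa [Finsupp.single_eq_of_ne hjo.symm] using hγo
            have hδd : δ.degree + 2 = k := by simp at hγd; omega
            have hle : δ o ≤ δ.degree := Finsupp.le_degree o δ
            rw [← add_assoc, add_tsub_cancel_right, MvPolynomial.coeff_pderiv,
              ih (r - 2) (by omega) p hp _ (by simp; omega) (by simp; omega), zero_mul]
          · rfl
        rw [h2, sub_zero] at h1
        exact (mul_eq_zero.1 h1).resolve_right (by positivity)
  rw [eq_bot_iff]
  intro p hp
  rw [Submodule.mem_bot]
  ext α
  rw [MvPolynomial.coeff_zero]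
  by_cases hd : α.degree = k
  · have hle : α o ≤ α.degree := Finsupp.le_degree o α
    exact key (k - α o) p hp α hd (by omega)
  · exact ((mem_polyHarm.1 (hW hp)).1).coeff_eq_zero hd

/-- The harmonic polynomials that are invariant under the rotations fixing the axis `o`, and whose
coefficients of degree one in the other variables vanish. -/
structure IsZonal (o : Fin m) (k : ℕ) (Z : MvPolynomial (Fin m) ℝ) : Prop where
  mem : Z ∈ polyHarm m k
  rot_eq_zero : ∀ i j, i ≠ o → j ≠ o → rot i j Z = 0
  coeff_eq_zero : ∀ α : Fin m →₀ ℕ, α o + 1 = k → Z.coeff α = 0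

theorem IsZonal.sub_smul {o : Fin m} {k : ℕ} {Y Z : MvPolynomial (Fin m) ℝ} (hY : IsZonal o k Y)
    (hZ : IsZonal o k Z) (a b : ℝ) : IsZonal o k (a • Y - b • Z) where
  mem := Submodule.sub_mem _ (Submodule.smul_mem _ _ hY.mem) (Submodule.smul_mem _ _ hZ.mem)
  rot_eq_zero i j hi hj := by
    rw [map_sub, map_smul, map_smul, hY.rot_eq_zero i j hi hj, hZ.rot_eq_zero i j hi hj]; simp
  coeff_eq_zero α h := by
    rw [MvPolynomial.coeff_sub, MvPolynomial.coeff_smul, MvPolynomial.coeff_smul,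
      hY.coeff_eq_zero α h, hZ.coeff_eq_zero α h]; simp

/-- Let ρ² be the sum of x_i² over i ≠ o. Invariance under rotations about the axis gives ρ² ∂_j Z =
x_j E. Applying ∂_j, summing over j ≠ o and replacing the transversal Laplacian by -∂_o² yields the
identity. -/
theorem IsZonal.euler_identity {o : Fin m} {k : ℕ} {Z : MvPolynomial (Fin m) ℝ}
    (hZ : IsZonal o k Z) (E : MvPolynomial (Fin m) ℝ)
    (hE : E = ∑ i ∈ Finset.univ.erase o, MvPolynomial.X i * MvPolynomial.pderiv i Z) :
    (∑ i ∈ Finset.univ.erase o, MvPolynomial.X i * MvPolynomial.pderiv i E) + ((m : ℝ) - 3) • E =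
      -∑ i ∈ Finset.univ.erase o, MvPolynomial.X i * (MvPolynomial.X i *
        MvPolynomial.pderiv o (MvPolynomial.pderiv o Z)) := by
  set T := (Finset.univ.erase o : Finset (Fin m)) with hT
  have hm : 1 ≤ m := Fin.pos o
  have hcard : (T.card : ℝ) = m - 1 := by
    rw [hT, Finset.card_erase_of_mem (Finset.mem_univ o), Finset.card_univ, Fintype.card_fin,
      Nat.cast_sub hm, Nat.cast_one]
  have h1 : ∀ j ∈ T, (∑ i ∈ T, MvPolynomial.X i * MvPolynomial.X i) * MvPolynomial.pderiv j Z =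
      MvPolynomial.X j * E := by
    intro j hj
    rw [hE, Finset.sum_mul, Finset.mul_sum]
    refine Finset.sum_congr rfl fun i hi => ?_
    have := hZ.rot_eq_zero i j (Finset.ne_of_mem_erase hi) (Finset.ne_of_mem_erase hj)
    rw [rot_apply] at this
    linear_combination MvPolynomial.X i * this
  set R : MvPolynomial (Fin m) ℝ := ∑ i ∈ T, MvPolynomial.X i * MvPolynomial.X i with hR
  have hdR : ∀ j ∈ T, MvPolynomial.pderiv j R = 2 * MvPolynomial.X j := by
    intro j hj
    rw [hR, map_sum, Finset.sum_eq_single_of_mem j hj]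
    · rw [MvPolynomial.pderiv_mul, MvPolynomial.pderiv_X_self]; ring
    · intro i _ hi
      rw [MvPolynomial.pderiv_mul, MvPolynomial.pderiv_X_of_ne hi]; ring
  have h2 : ∀ j ∈ T, 2 * (MvPolynomial.X j * MvPolynomial.pderiv j Z) +
      R * MvPolynomial.pderiv j (MvPolynomial.pderiv j Z) =
      E + MvPolynomial.X j * MvPolynomial.pderiv j E := by
    intro j hj
    have := congrArg (MvPolynomial.pderiv j) (h1 j hj)
    rw [MvPolynomial.pderiv_mul, MvPolynomial.pderiv_mul, hdR j hj,
      MvPolynomial.pderiv_X_self] at this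
    linear_combination this
  have h3 := Finset.sum_congr rfl h2
  rw [Finset.sum_add_distrib, Finset.sum_add_distrib, ← Finset.mul_sum, ← Finset.mul_sum, ← hE,
    Finset.sum_const, ← Nat.cast_smul_eq_nsmul ℝ, hcard] at h3
  have h4 : ∑ j ∈ T, MvPolynomial.pderiv j (MvPolynomial.pderiv j Z) =
      -MvPolynomial.pderiv o (MvPolynomial.pderiv o Z) := by
    have := (mem_polyHarm.1 hZ.mem).2
    rw [← Finset.add_sum_erase _ _ (Finset.mem_univ o)] at this
    exact eq_neg_of_add_eq_zero_right this
  rw [h4] at h3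
  have h5 : ∑ i ∈ T, MvPolynomial.X i * (MvPolynomial.X i *
      MvPolynomial.pderiv o (MvPolynomial.pderiv o Z)) =
      R * MvPolynomial.pderiv o (MvPolynomial.pderiv o Z) := by
    rw [hR, Finset.sum_mul]
    exact Finset.sum_congr rfl fun i _ => (mul_assoc _ _ _).symm
  rw [h5]
  have h6 : ((m : ℝ) - 3) • E = ((m : ℝ) - 1) • E - 2 * E := by
    rw [two_mul]; module
  rw [h6]
  linear_combination -h3

/-- Comparing coefficients in `IsZonal.euler_identity` expresses r(r + m - 3) times a coefficient of
transversal degree r through those of degree r - 2. The coefficient at x_o^k thus determines Z, and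
zonal harmonics are proportional. -/
theorem IsZonal.eq_zero {o : Fin m} {k : ℕ} {Z : MvPolynomial (Fin m) ℝ} (hZ : IsZonal o k Z)
    (h0 : Z.coeff (Finsupp.single o k) = 0) : Z = 0 := by
  set T := (Finset.univ.erase o : Finset (Fin m)) with hT
  have hhom := (mem_polyHarm.1 hZ.mem).1
  have key : ∀ r : ℕ, ∀ α : Fin m →₀ ℕ, ∑ i ∈ T, α i = r → Z.coeff α = 0 := by
    intro r
    induction r using Nat.strong_induction_on with
    | _ r ih =>
      intro α hr
      by_cases hd : α.degree = k
      swap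
      · exact hhom.coeff_eq_zero hd
      have hsum : α o + ∑ i ∈ T, α i = k := by
        rw [← hd, Finsupp.degree_eq_sum, ← Finset.add_sum_erase _ _ (Finset.mem_univ o)]
      rcases Nat.eq_zero_or_pos r with rfl | hr0
      · rw [eq_single_of_degree_eq hd (o := o) (by omega)]
        exact h0
      -- For r = 1 the factor r + m - 3 vanishes when m = 2; this is why the vanishing of these
      -- coefficients is part of `IsZonal`.
      · rcases Nat.lt_or_ge r 2 with hr1 | hr2
        · exact hZ.coeff_eq_zero α (by omega)
        · have hE : ∀ β : Fin m →₀ ℕ, ∀ p : MvPolynomial (Fin m) ℝ,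
              (∑ i ∈ T, MvPolynomial.X i * MvPolynomial.pderiv i p).coeff β =
              ((∑ i ∈ T, β i : ℕ) : ℝ) * p.coeff β := by
            intro β p
            rw [MvPolynomial.coeff_sum, Nat.cast_sum, Finset.sum_mul]
            exact Finset.sum_congr rfl fun i _ => coeff_X_mul_pderiv_self i p β
          have h1 := congrArg (MvPolynomial.coeff α) (hZ.euler_identity _ rfl)
          rw [MvPolynomial.coeff_add, MvPolynomial.coeff_smul, hE, hE, hr, MvPolynomial.coeff_neg,
            MvPolynomial.coeff_sum, Finset.sum_eq_zero, neg_zero] at h1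
          · have hm : 2 ≤ m := by
              by_contra hm
              have : T = ∅ := by
                rw [Finset.eq_empty_iff_forall_notMem]
                intro i hi
                exact Finset.ne_of_mem_erase hi (Fin.ext (by omega))
              rw [this] at hr; simp at hr; omega
            have hm' : (2 : ℝ) ≤ m := by exact_mod_cast hm
            have hr' : (2 : ℝ) ≤ r := by exact_mod_cast hr2
            have h2 : ((r : ℝ) * (r + m - 3)) * Z.coeff α = 0 := by
              rw [smul_eq_mul] at h1; linear_combination h1
            refine (mul_eq_zero.1 h2).resolve_left (mul_ne_zero ?_ ?_) <;> linarith
          · intro i hi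
            have hio : i ≠ o := Finset.ne_of_mem_erase hi
            rw [MvPolynomial.coeff_X_mul']
            split_ifs with hs
            swap
            · rfl
            rw [MvPolynomial.coeff_X_mul']
            split_ifs with hs'
            swap
            · rfl
            rw [MvPolynomial.coeff_pderiv, MvPolynomial.coeff_pderiv,
              ih (r - 2) (by omega), zero_mul, zero_mul]
            rw [Finsupp.mem_support_iff] at hs hs'
            have hlt : ∀ j ∈ T, j ≠ i → ((α - Finsupp.single i 1 - Finsupp.single i 1 +
                Finsupp.single o 1 + Finsupp.single o 1 : Fin m →₀ ℕ)) j = α j := by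
              intro j hj hji
              simp [Finsupp.single_eq_of_ne hji,
                Finsupp.single_eq_of_ne (Finset.ne_of_mem_erase hj)]
            rw [← Finset.add_sum_erase _ _ hi]
            rw [← Finset.add_sum_erase _ _ hi] at hr
            rw [Finset.sum_congr rfl fun j hj =>
              hlt j (Finset.mem_of_mem_erase hj) (Finset.ne_of_mem_erase hj)]
            generalize ∑ j ∈ T.erase i, α j = t at hr ⊢
            simp [Finsupp.single_eq_of_ne hio] at hs hs' ⊢
            omega
  ext α
  exact key _ α rfl

/-- Z is the Riesz representative on W of the coefficient at x_o^k. Rotations are skew, so for i, j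
≠ o the squared norm of `rot i j Z` is minus the x_o^k-coefficient of `rot i j (rot i j Z)`, which
is 0. Similarly ⟨rot o j Z, Z⟩ = 0 says that the coefficient of Z at x_o^{k-1} x_j vanishes. -/
theorem exists_isZonal {k : ℕ} (o : Fin m) {W : Submodule ℝ (MvPolynomial (Fin m) ℝ)}
    (hW : W ≤ polyHarm m k) (hst : ∀ i j, ∀ p ∈ W, rot i j p ∈ W) (hne : W ≠ ⊥) :
    ∃ Z ∈ W, Z ≠ 0 ∧ IsZonal o k Z := by
  have hfin : FiniteDimensional ℝ W := by
    have : FiniteDimensional ℝ (MvPolynomial.homogeneousSubmodule (Fin m) ℝ k) :=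
      Module.Finite.iff_fg.2 (MvPolynomial.homogeneousSubmodule_fg (Fin m) ℝ k)
    exact Submodule.finiteDimensional_of_le (hW.trans inf_le_left)
  let Φ : W →ₗ[ℝ] Module.Dual ℝ W := (polyForm m).domRestrict₁₂ W W
  have hΦ : Function.Injective Φ := by
    rw [injective_iff_map_eq_zero]
    intro p hp
    by_contra h
    have := polyForm_self_pos (p := (p : MvPolynomial (Fin m) ℝ)) (by simpa using h)
    have h' : Φ p p = polyForm m p p := rfl
    rw [hp] at h'
    simp [← h'] at this
  have hsurj := (LinearMap.injective_iff_surjective_of_finrank_eq_finrank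
    (Subspace.dual_finrank_eq (K := ℝ) (V := W)).symm).1 hΦ
  obtain ⟨Z, hZ⟩ := hsurj ((MvPolynomial.lcoeff ℝ (Finsupp.single o k)).domRestrict W)
  have hF : ∀ p ∈ W, polyForm m p Z = p.coeff (Finsupp.single o k) := by
    intro p hp
    have := congrArg (fun φ => φ ⟨p, hp⟩) hZ
    rw [polyForm_comm]
    exact this
  refine ⟨Z, Z.2, ?_, hW Z.2, ?_, ?_⟩
  · intro h
    refine hne (eq_bot_of_coeff_eq_zero o hW hst fun p hp => ?_)
    rw [← hF p hp, h, map_zero]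
  · intro i j hi hj
    by_contra h
    have h1 := polyForm_self_pos h
    rw [polyForm_rot, polyForm_comm, hF _ (hst i j _ (hst i j Z Z.2)), rot_apply,
      MvPolynomial.coeff_sub, MvPolynomial.coeff_X_mul', MvPolynomial.coeff_X_mul'] at h1
    simp [hi.symm, hj.symm] at h1
  · intro α hα
    by_cases hd : α.degree = k
    swap
    · exact ((mem_polyHarm.1 (hW Z.2)).1).coeff_eq_zero hd
    have hsum : α o + ∑ i ∈ Finset.univ.erase o, α i = k := by
      rw [← hd, Finsupp.degree_eq_sum, ← Finset.add_sum_erase _ _ (Finset.mem_univ o)]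
    obtain ⟨j, hj, hαj⟩ := Finset.exists_ne_zero_of_sum_ne_zero
      (show ∑ i ∈ Finset.univ.erase o, α i ≠ 0 by omega)
    have hjo : j ≠ o := Finset.ne_of_mem_erase hj
    obtain ⟨γ, rfl⟩ : ∃ γ : Fin m →₀ ℕ, α = γ + Finsupp.single j 1 :=
      ⟨α - Finsupp.single j 1, (tsub_add_cancel_of_le
        (Finsupp.single_le_iff.2 (Nat.one_le_iff_ne_zero.2 hαj))).symm⟩
    have hγo : γ o + 1 = k := by simpa [Finsupp.single_eq_of_ne hjo.symm] using hα
    have hγd : γ.degree + 1 = k := by simpa using hd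
    have hγ : Finsupp.single o 1 + γ = Finsupp.single o k :=
      eq_single_of_degree_eq (by simp; omega) (by simp; omega)
    have hγj : γ j = 0 := by
      have := DFunLike.congr_fun hγ j
      simpa [Finsupp.single_eq_of_ne hjo] using this
    have h1 := polyForm_rot o j (Z : MvPolynomial (Fin m) ℝ) Z
    rw [polyForm_comm (Z : MvPolynomial (Fin m) ℝ), hF _ (hst o j Z Z.2)] at h1
    have h2 : (rot o j (Z : MvPolynomial (Fin m) ℝ)).coeff (Finsupp.single o k) = 0 := by linarith
    rw [← hγ, rot_apply, MvPolynomial.coeff_sub, MvPolynomial.coeff_X_mul,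
      MvPolynomial.coeff_pderiv, MvPolynomial.coeff_X_mul', if_neg, sub_zero, hγj] at h2
    · simpa using h2
    · simp [Finsupp.single_eq_of_ne hjo, hγj]

theorem exists_polyForm_ne_zero {k : ℕ} (o : Fin m) {W V : Submodule ℝ (MvPolynomial (Fin m) ℝ)}
    (hW : W ≤ polyHarm m k) (hstW : ∀ i j, ∀ p ∈ W, rot i j p ∈ W) (hneW : W ≠ ⊥)
    (hV : V ≤ polyHarm m k) (hstV : ∀ i j, ∀ p ∈ V, rot i j p ∈ V) (hneV : V ≠ ⊥) :
    ∃ w ∈ W, ∃ v ∈ V, polyForm m w v ≠ 0 := by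
  obtain ⟨Y, hYW, hY0, hY⟩ := exists_isZonal o hW hstW hneW
  obtain ⟨Z, hZV, hZ0, hZ⟩ := exists_isZonal o hV hstV hneV
  refine ⟨Y, hYW, Z, hZV, ?_⟩
  have hY1 : Y.coeff (Finsupp.single o k) ≠ 0 := fun h => hY0 (hY.eq_zero h)
  have hZ1 : Z.coeff (Finsupp.single o k) ≠ 0 := fun h => hZ0 (hZ.eq_zero h)
  have h := (hY.sub_smul hZ (Z.coeff (Finsupp.single o k)) (Y.coeff (Finsupp.single o k))).eq_zero
    (by simp; ring)
  have h2 : Y = (Z.coeff (Finsupp.single o k))⁻¹ • Y.coeff (Finsupp.single o k) • Z := by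
    rw [← sub_eq_zero.1 h, smul_smul, inv_mul_cancel₀ hZ1, one_smul]
  rw [h2, map_smul, map_smul, LinearMap.smul_apply, LinearMap.smul_apply]
  have := polyForm_self_pos hZ0
  simp only [smul_eq_mul]
  positivity

/-! ### Splitting off a pair of anticommuting variables -/

/-- The spherical harmonics of degree `c` in the commuting variables and the pairs in `S`. -/
noncomputable def harmIn (m : ℕ) (S : Finset (Fin n)) (c : ℝ) : Submodule ℝ (SuperPoly m n) :=
  varsIn m S ⊓ (euler m n).eigenspace c ⊓ LinearMap.ker (laplace m n)

theorem mem_harmIn {S : Finset (Fin n)} {c : ℝ} {f : SuperPoly m n} :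
    f ∈ harmIn m S c ↔ f ∈ varsIn m S ∧ euler m n f = c • f ∧ laplace m n f = 0 := by
  simp [harmIn, and_assoc]

/-- Stability under the operators `L_{ij}` in the commuting variables and the pairs in `S`. -/
def IsStable (S : Finset (Fin n)) (W : Submodule ℝ (SuperPoly m n)) : Prop :=
  ∀ i j, Active S i → Active S j → ∀ f ∈ W, L i j f ∈ W

theorem euler_mem_varsIn {S : Finset (Fin n)} {f : SuperPoly m n} (hf : f ∈ varsIn m S) :
    euler m n f ∈ varsIn m S := by
  rw [mem_varsIn] at hf ⊢
  intro a ha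
  rw [partialX_euler, hf a ha]; simp

theorem eq_zero_of_eq_neg {f : SuperPoly m n} (h : f = -f) : f = 0 := by
  have h2 : (2 : ℝ) • f = 0 := by
    rw [two_smul]; nth_rewrite 1 [h]; exact neg_add_cancel f
  exact (smul_eq_zero.1 h2).resolve_left two_ne_zero

theorem partialX_inr_self (a : Fin n × Fin 2) (f : SuperPoly m n) :
    partialX (Sum.inr a) (partialX (Sum.inr a) f) = 0 := by
  have := partialX_comm (Sum.inr a) (Sum.inr a) f
  rw [sgn_inr, neg_one_smul] at this
  exact eq_zero_of_eq_neg this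

theorem X_inr_mul_self (a : Fin n × Fin 2) (f : SuperPoly m n) :
    X (Sum.inr a) * (X (Sum.inr a) * f) = 0 := by
  have := X_mul_X_mul (Sum.inr a) (Sum.inr a) f
  rw [sgn_inr, neg_one_smul] at this
  exact eq_zero_of_eq_neg this

theorem X_one_mul_X_zero (a : Fin n) (f : SuperPoly m n) :
    X (Sum.inr (a, 1)) * (X (Sum.inr (a, 0)) * f) =
      -(X (Sum.inr (a, 0)) * (X (Sum.inr (a, 1)) * f)) := by
  rw [X_mul_X_mul, sgn_inr, neg_one_smul]

theorem mem_varsIn_of_insert {S : Finset (Fin n)} {a : Fin n} {f : SuperPoly m n}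
    (hf : f ∈ varsIn m (insert a S)) (h0 : partialX (Sum.inr (a, 0)) f = 0)
    (h1 : partialX (Sum.inr (a, 1)) f = 0) : f ∈ varsIn m S := by
  rw [mem_varsIn] at hf ⊢
  rintro ⟨b, e⟩ hb
  by_cases h : b = a
  · subst h
    fin_cases e
    · exact h0
    · exact h1
  · exact hf (b, e) (by simp [h]; exact hb)

theorem exists_pair_decomposition {S : Finset (Fin n)} {a : Fin n} {f : SuperPoly m n}
    (hf : f ∈ varsIn m (insert a S)) :
    ∃ A ∈ varsIn m S, ∃ B ∈ varsIn m S, ∃ C ∈ varsIn m S, ∃ D ∈ varsIn m S,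
      f = A + X (Sum.inr (a, 0)) * B + X (Sum.inr (a, 1)) * C +
        X (Sum.inr (a, 0)) * (X (Sum.inr (a, 1)) * D) := by
  have act : ∀ e, Active (insert a S) (Sum.inr (a, e) : Idx m n) := fun e => by simp
  set d0 := partialX (m := m) (Sum.inr (a, 0)) with hd0
  set d1 := partialX (m := m) (Sum.inr (a, 1)) with hd1
  set t0 : SuperPoly m n := X (Sum.inr (a, 0)) with ht0
  set t1 : SuperPoly m n := X (Sum.inr (a, 1)) with ht1
  have s0 : ∀ g, d0 (d0 g) = 0 := partialX_inr_self _
  have s1 : ∀ g, d1 (d1 g) = 0 := partialX_inr_self _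
  have s01 : ∀ g, d0 (d1 g) = -d1 (d0 g) := fun g => by
    rw [hd0, hd1, partialX_comm, sgn_inr, neg_one_smul]
  have x00 : ∀ g, d0 (t0 * g) = g - t0 * d0 g := fun g => by
    rw [hd0, ht0, partialX_X_mul]; simp [sub_eq_add_neg]
  have x01 : ∀ g, d0 (t1 * g) = - (t1 * d0 g) := fun g => by
    rw [hd0, ht1, partialX_X_mul]; simp
  have x10 : ∀ g, d1 (t0 * g) = - (t0 * d1 g) := fun g => by
    rw [hd1, ht0, partialX_X_mul]; simp
  have x11 : ∀ g, d1 (t1 * g) = g - t1 * d1 g := fun g => by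
    rw [hd1, ht1, partialX_X_mul]; simp [sub_eq_add_neg]
  -- The components are read off from derivatives: D = ∂_1 ∂_0 f, ∂_1 f = C - θ_0 D and ∂_0 f = B +
  -- θ_1 D.
  have mD : d1 (d0 f) ∈ varsIn m (insert a S) := partialX_mem_varsIn _ (partialX_mem_varsIn _ hf)
  have mC : d1 f + t0 * d1 (d0 f) ∈ varsIn m (insert a S) :=
    Submodule.add_mem _ (partialX_mem_varsIn _ hf) (X_mul_mem_varsIn (act 0) mD)
  have mB : d0 f - t1 * d1 (d0 f) ∈ varsIn m (insert a S) :=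
    Submodule.sub_mem _ (partialX_mem_varsIn _ hf) (X_mul_mem_varsIn (act 1) mD)
  refine ⟨f - t0 * (d0 f - t1 * d1 (d0 f)) - t1 * (d1 f + t0 * d1 (d0 f)) -
    t0 * (t1 * d1 (d0 f)), mem_varsIn_of_insert (a := a) ?_ ?_ ?_,
    d0 f - t1 * d1 (d0 f), mem_varsIn_of_insert (a := a) mB ?_ ?_,
    d1 f + t0 * d1 (d0 f), mem_varsIn_of_insert (a := a) mC ?_ ?_,
    d1 (d0 f), mem_varsIn_of_insert (a := a) mD ?_ ?_, ?_⟩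
  · exact Submodule.sub_mem _ (Submodule.sub_mem _ (Submodule.sub_mem _ hf
      (X_mul_mem_varsIn (act 0) mB)) (X_mul_mem_varsIn (act 1) mC))
      (X_mul_mem_varsIn (act 0) (X_mul_mem_varsIn (act 1) mD))
  all_goals simp only [← hd0, ← hd1, map_sub, map_add, map_zero, x00, x01, x10, x11, s0,
    s1, s01, mul_zero, mul_sub, mul_add, mul_neg]
  all_goals abel

section Pair

variable {S : Finset (Fin n)} {a : Fin n} (ha : a ∉ S)

include ha

theorem partialX_zero_of_mem {f : SuperPoly m n} (hf : f ∈ varsIn m S) :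
    partialX (Sum.inr (a, 0)) f = 0 := mem_varsIn.1 hf _ ha

theorem partialX_one_of_mem {f : SuperPoly m n} (hf : f ∈ varsIn m S) :
    partialX (Sum.inr (a, 1)) f = 0 := mem_varsIn.1 hf _ ha

theorem X_zero_mul_inj {f : SuperPoly m n} (hf : f ∈ varsIn m S)
    (h : X (Sum.inr (a, 0)) * f = 0) : f = 0 := by
  have := congrArg (partialX (Sum.inr (a, 0))) h
  rw [partialX_X_mul, partialX_zero_of_mem ha hf] at this
  simpa using this

theorem pair_unique {A B C D : SuperPoly m n} (hA : A ∈ varsIn m S) (hB : B ∈ varsIn m S)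
    (hC : C ∈ varsIn m S) (hD : D ∈ varsIn m S)
    (h : A + X (Sum.inr (a, 0)) * B + X (Sum.inr (a, 1)) * C +
      X (Sum.inr (a, 0)) * (X (Sum.inr (a, 1)) * D) = 0) : A = 0 ∧ B = 0 ∧ C = 0 ∧ D = 0 := by
  have A0 := partialX_zero_of_mem ha hA
  have A1 := partialX_one_of_mem ha hA
  have B0 := partialX_zero_of_mem ha hB
  have B1 := partialX_one_of_mem ha hB
  have C0 := partialX_zero_of_mem ha hC
  have C1 := partialX_one_of_mem ha hC
  have D0 := partialX_zero_of_mem ha hD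
  have D1 := partialX_one_of_mem ha hD
  have h0 := congrArg (partialX (Sum.inr (a, 0))) h
  simp [partialX_X_mul, A0, B0, C0, D0] at h0
  have h01 := congrArg (partialX (Sum.inr (a, 1))) h0
  simp [partialX_X_mul, B1, D1] at h01
  subst h01
  simp at h0
  subst h0
  have h1 := congrArg (partialX (Sum.inr (a, 1))) h
  simp [partialX_X_mul, A1, C1] at h1
  subst h1
  simpa using h

theorem L_X_mul_of_active {i j : Idx m n} (hi : Active S i) (hj : Active S j) (e : Fin 2)
    (f : SuperPoly m n) : L i j (X (Sum.inr (a, e)) * f) =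
      (sgn i (Sum.inr (a, e)) * sgn j (Sum.inr (a, e))) • (X (Sum.inr (a, e)) * L i j f) := by
  have h : ∀ i : Idx m n, Active S i → bar i ≠ Sum.inr (a, e) := by
    intro i hi h
    rw [← active_bar, h] at hi
    exact ha hi
  rw [L_apply, L_apply, partialXup_X_mul, partialXup_X_mul, if_neg (h i hi), if_neg (h j hj),
    zero_add, zero_add, mul_smul_comm, mul_smul_comm, X_mul_X_mul i, X_mul_X_mul j]
  rw [mul_sub, mul_smul_comm]
  module

theorem L_X_X_mul_of_active {i j : Idx m n} (hi : Active S i) (hj : Active S j)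
    (f : SuperPoly m n) : L i j (X (Sum.inr (a, 0)) * (X (Sum.inr (a, 1)) * f)) =
      X (Sum.inr (a, 0)) * (X (Sum.inr (a, 1)) * L i j f) := by
  rw [L_X_mul_of_active ha hi hj, L_X_mul_of_active ha hi hj, mul_smul_comm, smul_smul]
  have : ∀ i : Idx m n, sgn i (Sum.inr (a, 0)) * sgn i (Sum.inr (a, 1)) = 1 := by
    intro i; rcases i with i | b <;> simp
  have h : sgn i (Sum.inr (a, 0)) * sgn j (Sum.inr (a, 0)) *
      (sgn i (Sum.inr (a, 1)) * sgn j (Sum.inr (a, 1))) = 1 := by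
    linear_combination (sgn j (Sum.inr (a, 0)) * sgn j (Sum.inr (a, 1))) * this i + this j
  rw [h, one_smul]

/-- This operator is 4 θ_0 ∂_{θ_1}; the D-term dies because θ_0² = 0, so C is isolated. -/
theorem L_zero_zero_pair {A B C D : SuperPoly m n} (hA : A ∈ varsIn m S) (hB : B ∈ varsIn m S)
    (hC : C ∈ varsIn m S) (hD : D ∈ varsIn m S) :
    L (Sum.inr (a, 0)) (Sum.inr (a, 0)) (A + X (Sum.inr (a, 0)) * B + X (Sum.inr (a, 1)) * C +
      X (Sum.inr (a, 0)) * (X (Sum.inr (a, 1)) * D)) = (4 : ℝ) • (X (Sum.inr (a, 0)) * C) := by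
  rw [L_apply]
  simp only [map_add, partialXup_apply, bar_inr_zero, lam_inr_zero, partialX_X_mul,
    partialX_one_of_mem ha hA, partialX_one_of_mem ha hB, partialX_one_of_mem ha hC,
    partialX_one_of_mem ha hD]
  simp [X_inr_mul_self, mul_add]
  module

/-- This is the weight operator -2 θ_0 ∂_{θ_0} + 2 θ_1 ∂_{θ_1}: A and θ_0 θ_1 D have weight zero, so
B is isolated. -/
theorem L_zero_one_pair {A B D : SuperPoly m n} (hA : A ∈ varsIn m S) (hB : B ∈ varsIn m S)
    (hD : D ∈ varsIn m S) :
    L (Sum.inr (a, 0)) (Sum.inr (a, 1)) (A + X (Sum.inr (a, 0)) * B +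
      X (Sum.inr (a, 0)) * (X (Sum.inr (a, 1)) * D)) = (-2 : ℝ) • (X (Sum.inr (a, 0)) * B) := by
  rw [L_apply]
  simp only [map_add, partialXup_apply, bar_inr_zero, lam_inr_zero, bar_inr_one, lam_inr_one,
    partialX_X_mul, partialX_one_of_mem ha hA, partialX_one_of_mem ha hB,
    partialX_one_of_mem ha hD, partialX_zero_of_mem ha hA, partialX_zero_of_mem ha hB,
    partialX_zero_of_mem ha hD]
  simp [X_one_mul_X_zero, mul_add]

/-- The factor after θ_0 is the obstruction whose vanishing defines almost invariance. -/
theorem L_zero_pair {A D : SuperPoly m n} (hA : A ∈ varsIn m S) (hD : D ∈ varsIn m S)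
    {j : Idx m n} (hj : Active S j) :
    L (Sum.inr (a, 0)) j (A + X (Sum.inr (a, 0)) * (X (Sum.inr (a, 1)) * D)) =
      X (Sum.inr (a, 0)) * (partialXup j A + (2 : ℝ) • (X j * D)) := by
  have h : ∀ e, bar j ≠ Sum.inr (a, e) := by
    intro e h
    rw [← active_bar, h] at hj
    exact ha hj
  rw [L_apply, map_add, map_add, partialXup_X_mul, if_neg (h 0)]
  simp only [partialXup_apply (Sum.inr (a, 0)), bar_inr_zero, lam_inr_zero, partialX_X_mul,
    partialX_one_of_mem ha hA, partialX_one_of_mem ha hD]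
  simp [mul_add, X_inr_mul_self]
  rw [X_mul_X_mul j, sgn_comm j]
  have := sgn_mul_self (Sum.inr (a, 0)) j
  rw [smul_comm (2 : ℝ), smul_smul, this, one_smul]

theorem euler_pair {f A B C D : SuperPoly m n} {c : ℝ} (hA : A ∈ varsIn m S)
    (hB : B ∈ varsIn m S) (hC : C ∈ varsIn m S) (hD : D ∈ varsIn m S)
    (hf : f = A + X (Sum.inr (a, 0)) * B + X (Sum.inr (a, 1)) * C +
      X (Sum.inr (a, 0)) * (X (Sum.inr (a, 1)) * D)) (h : euler m n f = c • f) :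
    euler m n A = c • A ∧ euler m n B = (c - 1) • B ∧ euler m n C = (c - 1) • C ∧
      euler m n D = (c - 2) • D := by
  have h1 : ∀ g ∈ varsIn m S, ∀ d : ℝ, euler m n g - d • g ∈ varsIn m S := fun g hg d =>
    Submodule.sub_mem _ (euler_mem_varsIn hg) (Submodule.smul_mem _ _ hg)
  obtain ⟨a1, a2, a3, a4⟩ := pair_unique ha (h1 A hA c) (h1 B hB (c - 1)) (h1 C hC (c - 1))
    (h1 D hD (c - 2)) (by
      rw [← sub_eq_zero, hf] at h
      rw [← h]
      simp only [map_add, euler_X_mul, mul_add, mul_sub, mul_smul_comm]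
      module)
  exact ⟨sub_eq_zero.1 a1, sub_eq_zero.1 a2, sub_eq_zero.1 a3, sub_eq_zero.1 a4⟩

theorem laplace_pair {A B C D : SuperPoly m n} (hB : B ∈ varsIn m S)
    (hC : C ∈ varsIn m S) (hD : D ∈ varsIn m S) :
    laplace m n (A + X (Sum.inr (a, 0)) * B + X (Sum.inr (a, 1)) * C +
      X (Sum.inr (a, 0)) * (X (Sum.inr (a, 1)) * D)) =
    (laplace m n A + (4 : ℝ) • D) + X (Sum.inr (a, 0)) * laplace m n B +
      X (Sum.inr (a, 1)) * laplace m n C +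
      X (Sum.inr (a, 0)) * (X (Sum.inr (a, 1)) * laplace m n D) := by
  simp only [map_add, laplace_X_mul, partialXup_apply, bar_inr_zero, lam_inr_zero, bar_inr_one,
    lam_inr_one, partialX_X_mul, partialX_one_of_mem ha hB, partialX_zero_of_mem ha hC,
    partialX_one_of_mem ha hD, partialX_zero_of_mem ha hD]
  simp
  module

theorem exists_harmIn_decomposition {f : SuperPoly m n} {c : ℝ}
    (hf : f ∈ harmIn m (insert a S) c) :
    ∃ A ∈ varsIn m S, ∃ B ∈ harmIn m S (c - 1), ∃ C ∈ harmIn m S (c - 1),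
      ∃ D ∈ harmIn m S (c - 2), euler m n A = c • A ∧ laplace m n A = (-4 : ℝ) • D ∧
      f = A + X (Sum.inr (a, 0)) * B + X (Sum.inr (a, 1)) * C +
        X (Sum.inr (a, 0)) * (X (Sum.inr (a, 1)) * D) := by
  obtain ⟨hv, he, hl⟩ := mem_harmIn.1 hf
  obtain ⟨A, hA, B, hB, C, hC, D, hD, hfe⟩ := exists_pair_decomposition hv
  obtain ⟨eA, eB, eC, eD⟩ := euler_pair ha hA hB hC hD hfe he
  rw [hfe, laplace_pair ha hB hC hD] at hl
  obtain ⟨lA, lB, lC, lD⟩ := pair_unique ha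
    (Submodule.add_mem _ (laplace_mem_varsIn hA) (Submodule.smul_mem _ _ hD))
    (laplace_mem_varsIn hB) (laplace_mem_varsIn hC) (laplace_mem_varsIn hD) hl
  exact ⟨A, hA, B, mem_harmIn.2 ⟨hB, eB, lB⟩, C, mem_harmIn.2 ⟨hC, eC, lC⟩, D,
    mem_harmIn.2 ⟨hD, eD, lD⟩, eA, by rw [neg_smul]; exact eq_neg_of_add_eq_zero_left lA, hfe⟩

theorem mem_harmIn_of_X_zero_mul_mem {B : SuperPoly m n} {c : ℝ} (hB : B ∈ varsIn m S)
    (h : X (Sum.inr (a, 0)) * B ∈ harmIn m (insert a S) c) : B ∈ harmIn m S (c - 1) := by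
  obtain ⟨-, he, hl⟩ := mem_harmIn.1 h
  refine mem_harmIn.2 ⟨hB, ?_, ?_⟩
  · rw [← sub_eq_zero]
    refine X_zero_mul_inj ha (Submodule.sub_mem _ (euler_mem_varsIn hB)
      (Submodule.smul_mem _ _ hB)) ?_
    rw [euler_X_mul] at he
    rw [mul_sub, mul_smul_comm, sub_smul, ← he]
    module
  · refine X_zero_mul_inj ha (laplace_mem_varsIn hB) ?_
    rw [laplace_X_mul, partialXup_apply, bar_inr_zero, partialX_one_of_mem ha hB] at hl
    simpa using hl

end Pair

/-! ### Pairing stable spaces of spherical harmonics -/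

theorem sgn_ne_zero (i j : Idx m n) : sgn i j ≠ 0 := by
  intro h
  have := sgn_mul_self i j
  rw [h] at this
  simp at this

theorem partialXup_eq_zero_of_not_active {S : Finset (Fin n)} {f : SuperPoly m n}
    (hf : f ∈ varsIn m S) {i : Idx m n} (hi : ¬ Active S i) : partialXup i f = 0 := by
  rw [partialXup_apply]
  rw [← active_bar] at hi
  rcases h : bar i with j | b
  · rw [h] at hi; exact absurd trivial hi
  · rw [h] at hi
    rw [mem_varsIn.1 hf b hi, smul_zero]

theorem eq_zero_of_partialXup_eq_zero {S : Finset (Fin n)} {f : SuperPoly m n} {c : ℝ}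
    (hf : f ∈ varsIn m S) (hc : c ≠ 0) (he : euler m n f = c • f)
    (h : ∀ i, Active S i → partialXup i f = 0) : f = 0 := by
  have h1 : ∀ i, partialX i f = 0 := by
    intro i
    have : partialXup (bar i) f = 0 := by
      by_cases hi : Active S (bar i)
      · exact h _ hi
      · exact partialXup_eq_zero_of_not_active hf hi
    rw [partialXup_apply, bar_bar] at this
    exact (smul_eq_zero.1 this).resolve_left (lam_ne_zero _)
  rw [euler_apply, Finset.sum_eq_zero fun i _ => by rw [h1, mul_zero]] at he
  exact (smul_eq_zero.1 he.symm).resolve_left hc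

/-- The degree is that of the D in an almost invariant vector. Adding a pair raises it by 2 while D
has degree two less than f, so the induction closes; it starts in a negative degree because m ≥ 3.
Once B = C = D = 0, invariance kills all derivatives of A, and A = 0 because its degree is odd. -/
theorem eq_zero_of_invariant (hm : 3 ≤ m) (hodd : Odd m) (S : Finset (Fin n)) :
    ∀ f ∈ varsIn m S, euler m n f = (2 - (m : ℝ) + 2 * S.card) • f →
      (∀ i j, Active S i → Active S j → L i j f = 0) → f = 0 := by
  induction S using Finset.induction_on with
  | empty =>
    intro f _ he _
    have hm' : (3 : ℝ) ≤ m := by exact_mod_cast hm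
    exact eq_zero_of_euler_neg (by simp; linarith) he
  | insert a S ha ih =>
    intro f hf he hL
    rw [Finset.card_insert_of_notMem ha] at he
    obtain ⟨A, hA, B, hB, C, hC, D, hD, rfl⟩ := exists_pair_decomposition hf
    obtain ⟨eA, -, -, eD⟩ := euler_pair ha hA hB hC hD rfl he
    have act : ∀ e, Active (insert a S) (Sum.inr (a, e) : Idx m n) := fun e => by simp
    have actS : ∀ i : Idx m n, Active S i → Active (insert a S) i := by
      rintro (i | b) hi
      · trivial
      · exact Finset.mem_insert_of_mem hi
    have hC0 : C = 0 := by
      have := hL _ _ (act 0) (act 0)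
      rw [L_zero_zero_pair ha hA hB hC hD] at this
      exact X_zero_mul_inj ha hC ((smul_eq_zero.1 this).resolve_left (by norm_num))
    subst hC0
    simp only [mul_zero, add_zero] at hL ⊢
    have hB0 : B = 0 := by
      have := hL _ _ (act 0) (act 1)
      rw [L_zero_one_pair ha hA hB hD] at this
      exact X_zero_mul_inj ha hB ((smul_eq_zero.1 this).resolve_left (by norm_num))
    subst hB0
    simp only [mul_zero, add_zero] at hL ⊢
    have hD0 : D = 0 := by
      refine ih D hD ?_ fun i j hi hj => ?_
      · rw [eD]; congr 1; push_cast; ring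
      · have := hL i j (actS i hi) (actS j hj)
        rw [map_add, L_X_X_mul_of_active ha hi hj] at this
        exact (pair_unique ha (L_mem_varsIn hi hj hA) (Submodule.zero_mem _)
          (Submodule.zero_mem _) (L_mem_varsIn hi hj hD) (by simpa using this)).2.2.2
    subst hD0
    have hA0 : A = 0 := by
      refine eq_zero_of_partialXup_eq_zero hA ?_ eA fun i hi => ?_
      · intro h
        obtain ⟨r, hr⟩ := hodd
        rw [hr] at h
        have h' : (2 : ℤ) - ((2 * r + 1 : ℕ) : ℤ) + 2 * ((S.card + 1 : ℕ) : ℤ) = 0 := by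
          exact_mod_cast h
        push_cast at h'
        omega
      · have := hL _ _ (act 0) (actS i hi)
        rw [L_zero_pair ha hA hD hi] at this
        have := X_zero_mul_inj ha (Submodule.add_mem _ (partialXup_mem_varsIn _ hA)
          (Submodule.smul_mem _ _ (X_mul_mem_varsIn hi hD))) this
        simpa using this
    simp [hA0]

/-- In one commuting variable a harmonic polynomial is affine, and each pair of θ's raises the top
degree by 2. -/
theorem harmIn_eq_bot_of_one (hm : m = 1) (S : Finset (Fin n)) :
    ∀ c : ℝ, 2 * (S.card : ℝ) + 2 ≤ c → harmIn m S c = ⊥ := by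
  induction S using Finset.induction_on with
  | empty =>
    intro c hc
    rw [Finset.card_empty] at hc
    rw [eq_bot_iff]
    intro f hf
    obtain ⟨hv, he, hl⟩ := mem_harmIn.1 hf
    subst hm
    rw [laplace_apply] at hl
    have h0 : ∀ b : Fin n × Fin 2, partialX (Sum.inr b) f = 0 := fun b =>
      mem_varsIn.1 hv b (Finset.notMem_empty _)
    simp only [Finset.univ_unique, Finset.sum_singleton, h0, map_zero, Finset.sum_const_zero,
      smul_zero, sub_zero] at hl
    have he' := euler_partialX he (Sum.inl default)
    rw [euler_apply, Fintype.sum_sum_type] at he he'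
    simp only [Finset.univ_unique, Finset.sum_singleton, hl, h0, mul_zero, Finset.sum_const_zero,
      add_zero, partialX_comm (Sum.inr _) (Sum.inl _), map_zero, smul_zero] at he he'
    have := (smul_eq_zero.1 he'.symm).resolve_left (by norm_num at hc ⊢; linarith)
    rw [this, mul_zero] at he
    exact (smul_eq_zero.1 he.symm).resolve_left (by norm_num at hc; linarith)
  | insert a S ha ih =>
    intro c hc
    rw [Finset.card_insert_of_notMem ha] at hc
    push_cast at hc
    rw [eq_bot_iff]
    intro f hf
    obtain ⟨A, hA, B, hB, C, hC, D, hD, eA, lA, rfl⟩ := exists_harmIn_decomposition ha hf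
    rw [ih (c - 1) (by linarith), Submodule.mem_bot] at hB hC
    rw [ih (c - 2) (by linarith), Submodule.mem_bot] at hD
    subst hB hC hD
    have : A ∈ harmIn m S c := mem_harmIn.2 ⟨hA, eA, by simpa using lA⟩
    rw [ih c (by linarith), Submodule.mem_bot] at this
    simp [this]

/-- The classical result for polynomials, transported along `polyIncl`. -/
theorem exists_form_ne_zero_of_empty {k : ℕ} (hk : k ≠ 0) {W V : Submodule ℝ (SuperPoly m n)}
    (hW : W ≤ harmIn m ∅ k) (hWs : IsStable ∅ W) (hWn : W ≠ ⊥)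
    (hV : V ≤ harmIn m ∅ k) (hVs : IsStable ∅ V) (hVn : V ≠ ⊥) :
    ∃ w ∈ W, ∃ v ∈ V, form m n w v ≠ 0 := by
  have hL : ∀ (i j : Fin m) (p : MvPolynomial (Fin m) ℝ),
      L (Sum.inl i) (Sum.inl j) (polyIncl m n p) = polyIncl m n (rot i j p) := by
    intro i j p
    rw [L_apply, partialXup_apply, partialXup_apply, rot_apply, map_sub, ← X_inl_mul_polyIncl,
      ← X_inl_mul_polyIncl, ← partialX_inl_polyIncl, ← partialX_inl_polyIncl]
    simp
  have hle : ∀ U : Submodule ℝ (SuperPoly m n), U ≤ harmIn m ∅ k →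
      U.comap (polyIncl m n) ≤ polyHarm m k := by
    intro U hU p hp
    obtain ⟨-, he, hl⟩ := mem_harmIn.1 (hU hp)
    rw [euler_apply, Fintype.sum_sum_type] at he
    simp only [partialX_inr_polyIncl, mul_zero, Finset.sum_const_zero, add_zero,
      partialX_inl_polyIncl, X_inl_mul_polyIncl, ← map_sum, ← map_smul] at he
    rw [laplace_apply] at hl
    simp only [partialX_inr_polyIncl, map_zero, Finset.sum_const_zero, smul_zero, sub_zero,
      partialX_inl_polyIncl, ← map_sum] at hl
    refine mem_polyHarm.2 ⟨?_, polyIncl_injective (by rw [hl, map_zero])⟩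
    have he' := polyIncl_injective he
    intro α hα
    have h1 := congrArg (MvPolynomial.coeff α) he'
    rw [MvPolynomial.coeff_sum, MvPolynomial.coeff_smul,
      Finset.sum_congr rfl fun i _ => coeff_X_mul_pderiv_self i p α, ← Finset.sum_mul,
      smul_eq_mul] at h1
    have h2 := mul_right_cancel₀ hα h1
    rw [Finsupp.weight_apply, Finsupp.sum_fintype _ _ (by simp)]
    simp
    exact_mod_cast h2
  have hne : ∀ U : Submodule ℝ (SuperPoly m n), U ≤ harmIn m ∅ k → U ≠ ⊥ →
      U.comap (polyIncl m n) ≠ ⊥ := by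
    intro U hU hn h
    obtain ⟨f, hf, hf0⟩ := Submodule.exists_mem_ne_zero_of_ne_bot hn
    obtain ⟨p, rfl⟩ := exists_polyIncl_eq (mem_harmIn.1 (hU hf)).1
    have : p ∈ U.comap (polyIncl m n) := hf
    rw [h, Submodule.mem_bot] at this
    exact hf0 (by rw [this, map_zero])
  have hst : ∀ U : Submodule ℝ (SuperPoly m n), IsStable ∅ U →
      ∀ i j, ∀ p ∈ U.comap (polyIncl m n), rot i j p ∈ U.comap (polyIncl m n) := by
    intro U hU i j p hp
    rw [Submodule.mem_comap, ← hL]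
    exact hU _ _ (active_inl _ i) (active_inl _ j) _ hp
  -- Without commuting variables there is no axis, but also no nonzero polynomial of positive
  -- degree.
  rcases Nat.eq_zero_or_pos m with rfl | hm
  · exfalso
    obtain ⟨p, hp, hp0⟩ := Submodule.exists_mem_ne_zero_of_ne_bot (hne W hW hWn)
    have := (mem_polyHarm.1 (hle W hW hp)).1
    exact hk (this.inj_right (MvPolynomial.isHomogeneous_of_isEmpty (Fin 0) ℝ p) hp0)
  · obtain ⟨w, hw, v, hv, h⟩ := exists_polyForm_ne_zero ⟨0, hm⟩ (hle W hW) (hst W hWs)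
      (hne W hW hWn) (hle V hV) (hst V hVs) (hne V hV hVn)
    exact ⟨_, hw, _, hv, by rwa [form_polyIncl]⟩

section Pair

variable {S : Finset (Fin n)} {a : Fin n} (ha : a ∉ S)

include ha

/-- A stable space of spherical harmonics contains either a multiple of `θ_{2a-1}` or an element
that is almost invariant. -/
theorem exists_singular {c : ℝ} {W : Submodule ℝ (SuperPoly m n)}
    (hW : W ≤ harmIn m (insert a S) c) (hWs : IsStable (insert a S) W) (hWn : W ≠ ⊥) :
    (∃ B ∈ varsIn m S, B ≠ 0 ∧ X (Sum.inr (a, 0)) * B ∈ W) ∨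
    ∃ A ∈ varsIn m S, ∃ D ∈ harmIn m S (c - 2), euler m n A = c • A ∧
      laplace m n A = (-4 : ℝ) • D ∧ A + X (Sum.inr (a, 0)) * (X (Sum.inr (a, 1)) * D) ∈ W ∧
      A + X (Sum.inr (a, 0)) * (X (Sum.inr (a, 1)) * D) ≠ 0 ∧
      ∀ j, Active S j → partialXup j A = (-2 : ℝ) • (X j * D) := by
  by_contra hcon
  rw [not_or] at hcon
  obtain ⟨h1, h2⟩ := hcon
  have h1' : ∀ B ∈ varsIn m S, X (Sum.inr (a, 0)) * B ∈ W → B = 0 := by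
    intro B hB hBW
    by_contra hB0
    exact h1 ⟨B, hB, hB0, hBW⟩
  have act : ∀ e, Active (insert a S) (Sum.inr (a, e) : Idx m n) := fun e => by simp
  have actS : ∀ i : Idx m n, Active S i → Active (insert a S) i := by
    rintro (i | b) hi
    · trivial
    · exact Finset.mem_insert_of_mem hi
  obtain ⟨f, hf, hf0⟩ := Submodule.exists_mem_ne_zero_of_ne_bot hWn
  obtain ⟨A, hA, B, hB, C, hC, D, hD, eA, lA, rfl⟩ := exists_harmIn_decomposition ha (hW hf)
  have hBv := (mem_harmIn.1 hB).1
  have hCv := (mem_harmIn.1 hC).1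
  have hDv := (mem_harmIn.1 hD).1
  have hC0 : C = 0 := by
    have := hWs _ _ (act 0) (act 0) _ hf
    rw [L_zero_zero_pair ha hA hBv hCv hDv] at this
    exact h1' C hCv ((Submodule.smul_mem_iff _ (by norm_num)).1 this)
  subst hC0
  simp only [mul_zero, add_zero] at hf hf0
  have hB0 : B = 0 := by
    have := hWs _ _ (act 0) (act 1) _ hf
    rw [L_zero_one_pair ha hA hBv hDv] at this
    exact h1' B hBv ((Submodule.smul_mem_iff _ (by norm_num)).1 this)
  subst hB0
  simp only [mul_zero, add_zero] at hf hf0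
  refine h2 ⟨A, hA, D, hD, eA, lA, hf, hf0, fun j hj => ?_⟩
  have := hWs _ _ (act 0) (actS j hj) _ hf
  rw [L_zero_pair ha hA hDv hj] at this
  have := h1' _ (Submodule.add_mem _ (partialXup_mem_varsIn _ hA)
    (Submodule.smul_mem _ _ (X_mul_mem_varsIn hj hDv))) this
  rw [neg_smul]
  exact eq_neg_of_add_eq_zero_left this

end Pair

/-! ### Almost invariant harmonics and the degree they force -/

section AlmostInvariant

variable {S : Finset (Fin n)}

/-- Contract the equations ∂_{X^j} A = -2 X_j D with the variables: the left side becomes 𝔼A and the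
right side R_S² D. -/
theorem euler_of_almost_invariant {A D : SuperPoly m n} (hA : A ∈ varsIn m S)
    (h : ∀ j, Active S j → partialXup j A = (-2 : ℝ) • (X j * D)) :
    euler m n A = (-2 : ℝ) • (rsq S * D) := by
  rw [euler_eq_of_mem_varsIn hA, rsq_mul, smul_sub, Finset.smul_sum, Finset.smul_sum,
    sub_eq_add_neg, ← Finset.sum_neg_distrib]
  congr 1
  · refine Finset.sum_congr rfl fun i _ => ?_
    have := h (Sum.inl i) trivial
    rw [partialXup_apply, lam_inl, one_smul, bar_inl] at this
    rw [this, mul_smul_comm]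
  · refine Finset.sum_congr rfl fun j hj => ?_
    have h0 := h (Sum.inr (j, 0)) hj
    have h1 := h (Sum.inr (j, 1)) hj
    rw [partialXup_apply, lam_inr_zero, bar_inr_zero] at h0
    rw [partialXup_apply, lam_inr_one, bar_inr_one] at h1
    have h0' : partialX (Sum.inr (j, 1)) A = -(X (Sum.inr (j, 0)) * D) := by
      have := congrArg (fun x => (1 / 2 : ℝ) • x) h0
      simp only [smul_smul] at this
      norm_num at this
      exact this
    have h1' : partialX (Sum.inr (j, 0)) A = X (Sum.inr (j, 1)) * D := by
      have := congrArg (fun x => (-1 / 2 : ℝ) • x) h1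
      simp only [smul_smul] at this
      norm_num at this
      exact this
    rw [h0', h1', mul_neg, X_one_mul_X_zero]
    module

/-- L_{ij} A is a combination of X_i X_j D and X_j X_i D that cancels, and D is a multiple of ∇²A,
with which L_{ij} commutes. -/
theorem L_eq_zero_of_almost_invariant {A D : SuperPoly m n}
    (h : ∀ j, Active S j → partialXup j A = (-2 : ℝ) • (X j * D))
    (hl : laplace m n A = (-4 : ℝ) • D) {i j : Idx m n} (hi : Active S i) (hj : Active S j) :
    L i j D = 0 := by
  have h1 : L i j A = 0 := by
    rw [L_apply, h i hi, h j hj, mul_smul_comm, mul_smul_comm, X_mul_X_mul i j]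
    module
  have h2 := L_laplace i j A
  rw [h1, map_zero, hl, map_smul] at h2
  exact (smul_eq_zero.1 h2).resolve_left (by norm_num)

/-- Apply ∇² to cA = -2 R_S² D: the left side is -4cD, and the sl₂ relation makes the right side
another multiple of D. -/
theorem degree_of_almost_invariant {a : Fin n} {A D : SuperPoly m n} {c : ℝ} (hc : c ≠ 0)
    (hA : A ∈ varsIn m S) (hD : D ∈ harmIn m S (c - 2)) (eA : euler m n A = c • A)
    (lA : laplace m n A = (-4 : ℝ) • D)
    (hne : A + X (Sum.inr (a, 0)) * (X (Sum.inr (a, 1)) * D) ≠ 0)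
    (h : ∀ j, Active S j → partialXup j A = (-2 : ℝ) • (X j * D)) :
    D ≠ 0 ∧ c + m = 4 + 2 * S.card := by
  obtain ⟨hDv, eD, lD⟩ := mem_harmIn.1 hD
  have h1 := euler_of_almost_invariant hA h
  rw [eA] at h1
  have hD0 : D ≠ 0 := by
    rintro rfl
    rw [mul_zero, smul_zero] at h1
    have hA0 := (smul_eq_zero.1 h1).resolve_left hc
    exact hne (by simp [hA0])
  refine ⟨hD0, ?_⟩
  have h2 := congrArg (laplace m n) h1
  rw [map_smul, map_smul, laplace_rsq_mul hDv, lA, lD, eD, mul_zero, zero_add] at h2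
  have h3 : (4 * (c + m - (4 + 2 * S.card))) • D = 0 := by
    rw [← sub_eq_zero] at h2
    rw [← h2]
    module
  have := (smul_eq_zero.1 h3).resolve_right hD0
  linarith

end AlmostInvariant

/-! ### Non-orthogonality of stable subspaces -/

theorem exists_form_ne_zero_of_degree_zero {S : Finset (Fin n)} {W V : Submodule ℝ (SuperPoly m n)}
    (hW : W ≤ harmIn m S 0) (hWn : W ≠ ⊥) (hV : V ≤ harmIn m S 0) (hVn : V ≠ ⊥) :
    ∃ w ∈ W, ∃ v ∈ V, form m n w v ≠ 0 := by
  obtain ⟨w, hw, hw0⟩ := Submodule.exists_mem_ne_zero_of_ne_bot hWn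
  obtain ⟨v, hv, hv0⟩ := Submodule.exists_mem_ne_zero_of_ne_bot hVn
  refine ⟨w, hw, v, hv, ?_⟩
  obtain ⟨r, rfl⟩ := exists_smul_one_of_euler_zero (by simpa using (mem_harmIn.1 (hW hw)).2.1)
  obtain ⟨t, rfl⟩ := exists_smul_one_of_euler_zero (by simpa using (mem_harmIn.1 (hV hv)).2.1)
  rw [map_smul, map_smul, LinearMap.smul_apply, form_one_one]
  simpa using ⟨(smul_ne_zero_iff.1 hv0).1, (smul_ne_zero_iff.1 hw0).1⟩

theorem form_X_zero_mul {S : Finset (Fin n)} {a : Fin n} (ha : a ∉ S) (f : SuperPoly m n)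
    {g : SuperPoly m n} (hg : g ∈ varsIn m S) :
    form m n (X (Sum.inr (a, 0)) * f) (X (Sum.inr (a, 0)) * g) = 2 * form m n f g := by
  rw [form_X_mul, lam_inr_zero, partialX_X_mul, partialX_zero_of_mem ha hg]
  simp

theorem form_X_one_mul {S : Finset (Fin n)} {a : Fin n} (ha : a ∉ S) (f : SuperPoly m n)
    {g : SuperPoly m n} (hg : g ∈ varsIn m S) :
    form m n (X (Sum.inr (a, 1)) * f) (X (Sum.inr (a, 1)) * g) = -2 * form m n f g := by
  rw [form_X_mul, lam_inr_one, partialX_X_mul, partialX_one_of_mem ha hg]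
  simp

/-- Since cA = -2 R_S² D and R_S² is adjoint to ∇², c⟨A, A'⟩ = 8⟨D, D'⟩; the other diagonal term is
-4⟨D, D'⟩ and the cross terms vanish. -/
theorem form_almost_invariant {S : Finset (Fin n)} {a : Fin n} (ha : a ∉ S)
    {A D A' D' : SuperPoly m n} {c : ℝ} (hA : A ∈ varsIn m S) (hA' : A' ∈ varsIn m S)
    (hD' : D' ∈ varsIn m S)
    (eA : euler m n A = c • A) (h : ∀ j, Active S j → partialXup j A = (-2 : ℝ) • (X j * D))
    (lA' : laplace m n A' = (-4 : ℝ) • D') :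
    c * form m n (A + X (Sum.inr (a, 0)) * (X (Sum.inr (a, 1)) * D))
      (A' + X (Sum.inr (a, 0)) * (X (Sum.inr (a, 1)) * D')) =
    (8 - 4 * c) * form m n D D' := by
  have hx : ∀ g, ∀ A ∈ varsIn m S, form m n (X (Sum.inr (a, 0)) * g) A = 0 := by
    intro g A hA
    rw [form_X_mul, partialX_zero_of_mem ha hA, map_zero, mul_zero]
  have h1 : c * form m n A A' = 8 * form m n D D' := by
    have := congrArg (fun f => form m n f A') (euler_of_almost_invariant hA h)
    simp only [eA, map_smul, LinearMap.smul_apply, form_rsq_mul D hA', lA', smul_eq_mul] at this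
    linarith
  have h2 : form m n (X (Sum.inr (a, 0)) * (X (Sum.inr (a, 1)) * D))
      (X (Sum.inr (a, 0)) * (X (Sum.inr (a, 1)) * D')) = -4 * form m n D D' := by
    rw [form_X_mul, lam_inr_zero, partialX_X_mul, partialX_X_mul, partialX_zero_of_mem ha hD']
    simp only [if_true, mul_zero, smul_zero, add_zero]
    have hne : (Sum.inr (a, 0) : Idx m n) ≠ Sum.inr (a, 1) := by simp
    rw [if_neg hne, mul_zero, smul_zero, add_zero, form_X_one_mul ha _ hD']
    ring
  rw [map_add (form m n), LinearMap.add_apply, map_add, map_add, h2, hx _ _ hA',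
    form_comm A (X _ * _), hx _ _ hA]
  linear_combination h1

/-- Almost invariant spherical harmonics occur, outside the excluded degrees, only for `m = 1` and
`k = 2 |S| + 3`. -/
theorem eq_one_of_almost_invariant {S : Finset (Fin n)} {a : Fin n} {k : ℕ} (hk0 : k ≠ 0)
    (hk : ¬ (Even m ∧ 4 + 2 * (S.card + 1) ≤ 2 * k + m ∧ k + m ≤ 2 + 2 * (S.card + 1)))
    {A D : SuperPoly m n} (hA : A ∈ varsIn m S) (hD : D ∈ harmIn m S (k - 2))
    (eA : euler m n A = (k : ℝ) • A) (lA : laplace m n A = (-4 : ℝ) • D)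
    (hne : A + X (Sum.inr (a, 0)) * (X (Sum.inr (a, 1)) * D) ≠ 0)
    (h : ∀ j, Active S j → partialXup j A = (-2 : ℝ) • (X j * D)) :
    D ≠ 0 ∧ m = 1 ∧ k = 3 + 2 * S.card := by
  obtain ⟨hD0, hdeg⟩ := degree_of_almost_invariant (Nat.cast_ne_zero.2 hk0) hA hD eA lA hne h
  have hdeg' : k + m = 4 + 2 * S.card := by exact_mod_cast hdeg
  refine ⟨hD0, ?_⟩
  have hodd : Odd m := by
    rw [← Nat.not_even_iff_odd]
    intro he
    refine hk ⟨he, ?_, ?_⟩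
    -- From k + m = 4 + 2|S| with m even, k is even; being nonzero it is at least 2, which is the
    -- lower bound of the exceptional range.
    · obtain ⟨r, hr⟩ := he; omega
    · omega
  have hm : m = 1 := by
    by_contra hm1
    have hm3 : 3 ≤ m := by obtain ⟨r, hr⟩ := hodd; omega
    refine hD0 (eq_zero_of_invariant hm3 hodd S D (mem_harmIn.1 hD).1 ?_
      fun i j hi hj => L_eq_zero_of_almost_invariant h lA hi hj)
    rw [(mem_harmIn.1 hD).2.1]
    congr 1
    linarith
  exact ⟨hm, by omega⟩

/-- Two subspaces are compared, rather than one with its complement, because this survives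
restriction to fewer variables: the parts of W and V divisible by θ_0 yield two unrelated stable
spaces. -/
theorem exists_form_ne_zero (S : Finset (Fin n)) :
    ∀ k : ℕ, ¬ (Even m ∧ 4 + 2 * S.card ≤ 2 * k + m ∧ k + m ≤ 2 + 2 * S.card) →
      ∀ W V : Submodule ℝ (SuperPoly m n), W ≤ harmIn m S k → IsStable S W → W ≠ ⊥ →
        V ≤ harmIn m S k → IsStable S V → V ≠ ⊥ → ∃ w ∈ W, ∃ v ∈ V, form m n w v ≠ 0 := by
  induction S using Finset.induction_on with
  | empty =>
    intro k _ W V hW hWs hWn hV hVs hVn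
    by_cases hk0 : k = 0
    · subst hk0
      rw [Nat.cast_zero] at hW hV
      exact exists_form_ne_zero_of_degree_zero hW hWn hV hVn
    · exact exists_form_ne_zero_of_empty hk0 hW hWs hWn hV hVs hVn
  | insert a S ha ih =>
    intro k hk W V hW hWs hWn hV hVs hVn
    by_cases hk0 : k = 0
    · subst hk0
      rw [Nat.cast_zero] at hW hV
      exact exists_form_ne_zero_of_degree_zero hW hWn hV hVn
    rw [Finset.card_insert_of_notMem ha] at hk
    have hk1 : ((k - 1 : ℕ) : ℝ) = (k : ℝ) - 1 := by
      rw [Nat.cast_sub (Nat.one_le_iff_ne_zero.2 hk0), Nat.cast_one]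
    have hstep : ∀ U : Submodule ℝ (SuperPoly m n), U ≤ harmIn m (insert a S) k →
        ∀ B ∈ varsIn m S, X (Sum.inr (a, 0)) * B ∈ U → B ∈ harmIn m S (k - 1 : ℕ) := by
      intro U hU B hB hBU
      rw [hk1]
      exact mem_harmIn_of_X_zero_mul_mem ha hB (hU hBU)
    -- In the only degree with almost invariant vectors, no vector θ_0 B with B ≠ 0 exists, so W and
    -- V are of the same type.
    have hbot : m = 1 → k = 3 + 2 * S.card → harmIn m S (k - 1 : ℕ) = ⊥ := by
      intro h1 h2
      refine harmIn_eq_bot_of_one h1 S _ (le_of_eq ?_)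
      rw [h2]
      have : 3 + 2 * S.card - 1 = 2 * S.card + 2 := by omega
      rw [this]; push_cast; ring
    rcases exists_singular ha hW hWs hWn with
      ⟨B, hB, hB0, hBW⟩ | ⟨A, hA, D, hD, eA, lA, hf, hf0, hAD⟩
    · rcases exists_singular ha hV hVs hVn with
        ⟨B', hB', hB0', hBV⟩ | ⟨A', hA', D', hD', eA', lA', hf', hf0', hAD'⟩
      · have hlift : ∀ U : Submodule ℝ (SuperPoly m n), IsStable (insert a S) U →
            IsStable S (varsIn m S ⊓ U.comap (LinearMap.mulLeft ℝ (X (Sum.inr (a, 0))))) := by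
          rintro U hU i j hi hj f ⟨hf1, hf2⟩
          refine ⟨L_mem_varsIn hi hj hf1, ?_⟩
          have actS : ∀ i : Idx m n, Active S i → Active (insert a S) i := by
            rintro (i | b) hi
            · trivial
            · exact Finset.mem_insert_of_mem hi
          have := hU i j (actS i hi) (actS j hj) _ hf2
          rw [LinearMap.mulLeft_apply, L_X_mul_of_active ha hi hj] at this
          exact (Submodule.smul_mem_iff U (mul_ne_zero (sgn_ne_zero _ _) (sgn_ne_zero _ _))).1 this
        have hle : ∀ U : Submodule ℝ (SuperPoly m n), U ≤ harmIn m (insert a S) k →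
            varsIn m S ⊓ U.comap (LinearMap.mulLeft ℝ (X (Sum.inr (a, 0)))) ≤
              harmIn m S (k - 1 : ℕ) := fun U hU f hf => hstep U hU f hf.1 hf.2
        -- If k - 1 were exceptional for S, then k would be exceptional for S with one more pair.
        obtain ⟨w, hw, v, hv, hwv⟩ := ih (k - 1) (fun h => hk (by
            refine ⟨h.1, ?_, ?_⟩ <;> omega)) _ _
          (hle W hW) (hlift W hWs)
          (Submodule.ne_bot_iff _ |>.2 ⟨B, ⟨hB, hBW⟩, hB0⟩)
          (hle V hV) (hlift V hVs)
          (Submodule.ne_bot_iff _ |>.2 ⟨B', ⟨hB', hBV⟩, hB0'⟩)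
        refine ⟨_, hw.2, _, hv.2, ?_⟩
        rw [LinearMap.mulLeft_apply, LinearMap.mulLeft_apply, form_X_zero_mul ha _ hv.1]
        exact mul_ne_zero two_ne_zero hwv
      · obtain ⟨-, h1, h2⟩ := eq_one_of_almost_invariant hk0 hk hA' hD' eA' lA' hf0' hAD'
        have := hstep W hW B hB hBW
        rw [hbot h1 h2, Submodule.mem_bot] at this
        exact absurd this hB0
    · obtain ⟨hD0, h1, h2⟩ := eq_one_of_almost_invariant hk0 hk hA hD eA lA hf0 hAD
      rcases exists_singular ha hV hVs hVn with
        ⟨B', hB', hB0', hBV⟩ | ⟨A', hA', D', hD', eA', lA', hf', hf0', hAD'⟩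
      · have := hstep V hV B' hB' hBV
        rw [hbot h1 h2, Submodule.mem_bot] at this
        exact absurd this hB0'
      · obtain ⟨hD0', -, -⟩ := eq_one_of_almost_invariant hk0 hk hA' hD' eA' lA' hf0' hAD'
        have hk2 : ((k - 2 : ℕ) : ℝ) = (k : ℝ) - 2 := by
          rw [Nat.cast_sub (by omega), Nat.cast_two]
        have hline : ∀ E : SuperPoly m n, (∀ i j, Active S i → Active S j → L i j E = 0) →
            IsStable S (Submodule.span ℝ {E}) := by
          intro E hE i j hi hj f hf
          obtain ⟨r, rfl⟩ := Submodule.mem_span_singleton.1 hf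
          rw [map_smul, hE i j hi hj, smul_zero]
          exact Submodule.zero_mem _
        -- The lines through D and D' are stable because D and D' are invariant; no degree is
        -- exceptional here, as m = 1 is odd.
        obtain ⟨w, hw, v, hv, hwv⟩ := ih (k - 2) (fun h => by
            have := h.1; rw [h1] at this; simp at this)
          (Submodule.span ℝ {D}) (Submodule.span ℝ {D'})
          (by rw [hk2, Submodule.span_singleton_le_iff_mem]; exact hD)
          (hline D fun i j hi hj => L_eq_zero_of_almost_invariant hAD lA hi hj)
          (by simpa using hD0)
          (by rw [hk2, Submodule.span_singleton_le_iff_mem]; exact hD')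
          (hline D' fun i j hi hj => L_eq_zero_of_almost_invariant hAD' lA' hi hj)
          (by simpa using hD0')
        refine ⟨_, hf, _, hf', fun h0 => hwv ?_⟩
        have h3 := form_almost_invariant ha hA hA' (mem_harmIn.1 hD').1 eA hAD lA'
        rw [h0, mul_zero] at h3
        -- Here k = 3 + 2|S| exceeds 2.
        have h4 : (8 - 4 * (k : ℝ)) ≠ 0 := by
          rw [h2]; push_cast
          have : (0 : ℝ) ≤ S.card := Nat.cast_nonneg _
          intro h
          linarith
        have h5 := (mul_eq_zero.1 h3.symm).resolve_left h4
        obtain ⟨r, rfl⟩ := Submodule.mem_span_singleton.1 hw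
        obtain ⟨t, rfl⟩ := Submodule.mem_span_singleton.1 hv
        rw [map_smul, map_smul, LinearMap.smul_apply, h5]
        simp

/-! ### Existence of spherical harmonics -/

theorem harmIn_mono {S T : Finset (Fin n)} (h : S ⊆ T) (c : ℝ) : harmIn m S c ≤ harmIn m T c := by
  intro f hf
  rw [mem_harmIn] at hf ⊢
  exact ⟨varsIn_mono h hf.1, hf.2⟩

theorem one_mem_harmIn (S : Finset (Fin n)) : (1 : SuperPoly m n) ∈ harmIn m S 0 := by
  refine mem_harmIn.2 ⟨one_mem_varsIn S, ?_, ?_⟩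
  · rw [euler_apply]; simp [partialX_one]
  · rw [laplace_apply]; simp [partialX_one]

theorem superPoly_one_ne_zero : (1 : SuperPoly m n) ≠ 0 := by
  intro h
  have := form_one_one (m := m) (n := n)
  rw [h] at this
  simp at this

/-- The real and imaginary parts of `(x_o + i x_p)^k`. -/
theorem exists_conjugate_harmonics {o p : Fin m} (hop : o ≠ p) (k : ℕ) :
    ∃ u v : SuperPoly m n, (∀ i, i ≠ Sum.inl o → i ≠ Sum.inl p →
      partialX i u = 0 ∧ partialX i v = 0) ∧
      partialX (Sum.inl o) u = partialX (Sum.inl p) v ∧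
      partialX (Sum.inl p) u = -partialX (Sum.inl o) v ∧
      euler m n u = (k : ℝ) • u ∧ euler m n v = (k : ℝ) • v ∧ u ≠ 0 := by
  have hop' : (Sum.inl o : Idx m n) ≠ Sum.inl p := by simpa using hop
  induction k with
  | zero =>
    refine ⟨1, 0, fun i _ _ => ⟨partialX_one i, map_zero _⟩, ?_, ?_, ?_, ?_,
      superPoly_one_ne_zero⟩
    · simp [partialX_one]
    · simp [partialX_one]
    · rw [euler_apply]; simp [partialX_one]
    · simp
  | succ k ih =>
    obtain ⟨u, v, h0, h1, h2, hu, hv, hne⟩ := ih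
    have hu1 : partialX (Sum.inl o) (X (Sum.inl o) * u - X (Sum.inl p) * v) =
        ((k : ℝ) + 1) • u := by
      have : euler m n u = X (Sum.inl o) * partialX (Sum.inl o) u +
          X (Sum.inl p) * partialX (Sum.inl p) u := by
        rw [euler_apply]
        exact Fintype.sum_eq_add _ _ hop' fun i hi => by rw [(h0 i hi.1 hi.2).1, mul_zero]
      rw [hu, h2] at this
      simp only [map_sub, partialX_X_mul, if_true, if_neg hop', sgn_inl_left, one_smul]
      rw [add_smul, one_smul, this]
      simp only [mul_neg]
      abel
    refine ⟨X (Sum.inl o) * u - X (Sum.inl p) * v, X (Sum.inl o) * v + X (Sum.inl p) * u,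
      fun i ho hp => ?_, ?_, ?_, ?_, ?_, ?_⟩
    · simp [partialX_X_mul, ho, hp, h0 i ho hp]
    · simp only [map_sub, map_add, partialX_X_mul, if_true, if_neg hop', if_neg hop'.symm, h1, h2]
      simp
      abel
    · simp only [map_sub, map_add, partialX_X_mul, if_true, if_neg hop', if_neg hop'.symm, h1, h2]
      simp
      abel
    · rw [map_sub, euler_X_mul, euler_X_mul, hu, hv]
      push_cast
      simp only [mul_smul_comm]
      module
    · rw [map_add, euler_X_mul, euler_X_mul, hu, hv]
      push_cast
      simp only [mul_smul_comm]
      module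
    · intro h
      rw [h, map_zero] at hu1
      exact hne ((smul_eq_zero.1 hu1.symm).resolve_left (by positivity))

theorem exists_mem_harmIn_empty (hm : 2 ≤ m) (k : ℕ) :
    ∃ u ∈ harmIn m (∅ : Finset (Fin n)) k, u ≠ 0 := by
  have hop : (⟨0, by omega⟩ : Fin m) ≠ ⟨1, by omega⟩ := by simp
  obtain ⟨u, v, h0, h1, h2, hu, -, hne⟩ := exists_conjugate_harmonics (n := n) hop k
  refine ⟨u, mem_harmIn.2 ⟨mem_varsIn.2 fun a _ => (h0 _ (by simp) (by simp)).1, hu, ?_⟩, hne⟩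
  rw [laplace_apply, Fintype.sum_eq_add _ _ hop fun i hi => by
    rw [(h0 (Sum.inl i) (by simpa using hi.1) (by simpa using hi.2)).1, map_zero], h1, h2,
    map_neg, partialX_comm]
  simp [(h0 _ (Sum.inr_ne_inl) (Sum.inr_ne_inl)).1]

/-- For m ≥ 2 a classical harmonic serves. Otherwise multiply a harmonic of degree k - 1 by a new
θ_0; only the top degree for m = 1 is out of reach in this way. -/
theorem harmIn_ne_bot (S : Finset (Fin n)) :
    ∀ k : ℕ, (m = 0 → k ≤ S.card) → (m = 1 → k ≤ 2 * S.card + 1) → harmIn m S k ≠ ⊥ := by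
  by_cases hm : 2 ≤ m
  · intro k _ _ h
    obtain ⟨u, hu, hu0⟩ := exists_mem_harmIn_empty (n := n) hm k
    have := harmIn_mono (Finset.empty_subset S) _ hu
    rw [h, Submodule.mem_bot] at this
    exact hu0 this
  have hzero : ∀ T : Finset (Fin n), harmIn m T ((0 : ℕ) : ℝ) ≠ ⊥ := by
    intro T h
    have := one_mem_harmIn (m := m) T
    rw [Nat.cast_zero] at h
    rw [h, Submodule.mem_bot] at this
    exact superPoly_one_ne_zero this
  induction S using Finset.induction_on with
  | empty =>
    intro k h0 h1
    rw [Finset.card_empty] at h0 h1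
    rcases Nat.eq_zero_or_pos k with rfl | hk
    · exact hzero _
    obtain rfl : m = 1 := by omega
    obtain rfl : k = 1 := by omega
    intro h
    have hx : X (Sum.inl 0) * (1 : SuperPoly 1 n) ∈ harmIn 1 (∅ : Finset (Fin n)) (1 : ℕ) := by
      have h1 := mem_harmIn.1 (one_mem_harmIn (m := 1) (∅ : Finset (Fin n)))
      refine mem_harmIn.2 ⟨X_mul_mem_varsIn (active_inl _ _) h1.1, ?_, ?_⟩
      · rw [euler_X_mul, h1.2.1]; simp
      · rw [laplace_X_mul, h1.2.2, partialXup_apply, partialX_one]; simp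
    rw [h, Submodule.mem_bot] at hx
    have := congrArg (partialX (Sum.inl 0)) hx
    rw [partialX_X_mul, partialX_one] at this
    exact superPoly_one_ne_zero (by simpa using this)
  | insert a S ha ih =>
    intro k h0 h1
    rw [Finset.card_insert_of_notMem ha] at h0 h1
    rcases Nat.eq_zero_or_pos k with rfl | hk
    · exact hzero _
    -- In the top degree the witness is the almost invariant vector built on a D of degree 2|S| + 1;
    -- the coefficient -2/k is forced by kA = -2 R_S² D.
    by_cases hlast : m = 1 ∧ k = 2 * S.card + 3
    · obtain ⟨rfl, rfl⟩ := hlast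
      obtain ⟨D, hD, hD0⟩ := Submodule.exists_mem_ne_zero_of_ne_bot
        (ih (2 * S.card + 1) (by omega) (by omega))
      obtain ⟨hDv, eD, lD⟩ := mem_harmIn.1 hD
      rw [Submodule.ne_bot_iff]
      set k : ℝ := ((2 * S.card + 3 : ℕ) : ℝ) with hk'
      have hkpos : k ≠ 0 := Nat.cast_ne_zero.2 (by omega)
      have hA : (-2 / k) • (rsq S * D) ∈ varsIn 1 S :=
        Submodule.smul_mem _ _ (rsq_mul_mem_varsIn hDv)
      refine ⟨(-2 / k) • (rsq S * D) + X (Sum.inr (a, 0)) * (X (Sum.inr (a, 1)) * D),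
        mem_harmIn.2 ⟨?_, ?_, ?_⟩, ?_⟩
      · refine Submodule.add_mem _ (varsIn_mono (Finset.subset_insert a S) hA)
          (X_mul_mem_varsIn (by simp) (X_mul_mem_varsIn (by simp) ?_))
        exact varsIn_mono (Finset.subset_insert a S) hDv
      · rw [map_add, map_smul, euler_rsq_mul, euler_X_mul, euler_X_mul, eD, hk']
        push_cast
        simp only [mul_smul_comm, mul_add]
        module
      · have := laplace_pair (A := (-2 / k) • (rsq S * D)) ha (Submodule.zero_mem _)
          (Submodule.zero_mem _) hDv
        simp only [mul_zero, add_zero, map_zero, lD] at this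
        rw [this, map_smul, laplace_rsq_mul hDv, lD, eD, mul_zero, zero_add, smul_smul, ← add_smul,
          smul_smul, ← add_smul]
        have : -2 / k * (4 * ((2 * S.card + 1 : ℕ) : ℝ) + 2 * (((1 : ℕ) : ℝ) - 2 * S.card)) + 4
            = 0 := by
          field_simp
          rw [hk']
          push_cast
          ring
        rw [this, zero_smul]
      · intro h
        exact hD0 (pair_unique ha hA (Submodule.zero_mem _) (Submodule.zero_mem _) hDv
          (by simpa using h)).2.2.2
    · obtain ⟨B, hB, hB0⟩ := Submodule.exists_mem_ne_zero_of_ne_bot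
        (ih (k - 1) (by omega) (by omega))
      obtain ⟨hBv, eB, lB⟩ := mem_harmIn.1 hB
      rw [Submodule.ne_bot_iff]
      refine ⟨X (Sum.inr (a, 0)) * B, mem_harmIn.2 ⟨X_mul_mem_varsIn (by simp)
        (varsIn_mono (Finset.subset_insert a S) hBv), ?_, ?_⟩,
        fun h => hB0 (X_zero_mul_inj ha hBv h)⟩
      · rw [euler_X_mul, eB, Nat.cast_sub hk]
        simp only [mul_smul_comm]
        push_cast
        module
      · rw [laplace_X_mul, lB, partialXup_apply, bar_inr_zero, partialX_one_of_mem ha hBv]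
        simp

/-! ### Multiplication by powers of `R²` -/

theorem euler_Rsq_pow_mul {f : SuperPoly m n} {c : ℝ} (hf : euler m n f = c • f) (s : ℕ) :
    euler m n (Rsq m n ^ s * f) = (c + 2 * s) • (Rsq m n ^ s * f) := by
  induction s with
  | zero => simp [hf]
  | succ s ih =>
    rw [pow_succ', mul_assoc, Rsq_eq_rsq, euler_rsq_mul, ← Rsq_eq_rsq, ih]
    push_cast
    simp only [mul_smul_comm]
    module

/-- Iterating the sl₂ relation. The zero of this factor in degree c = 2 - M - k is what makes ℋ_k
reducible. -/
theorem laplace_Rsq_pow_mul {f : SuperPoly m n} {c : ℝ} (hf : euler m n f = c • f)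
    (hl : laplace m n f = 0) (s : ℕ) :
    laplace m n (Rsq m n ^ (s + 1) * f) =
      (2 * (s + 1) * ((m : ℝ) - 2 * n + 2 * c + 2 * s)) • (Rsq m n ^ s * f) := by
  have key : ∀ g : SuperPoly m n, laplace m n (Rsq m n * g) = Rsq m n * laplace m n g +
      (4 : ℝ) • euler m n g + (2 * ((m : ℝ) - 2 * n)) • g := by
    intro g
    rw [Rsq_eq_rsq, laplace_rsq_mul (by rw [varsIn_univ]; trivial), Finset.card_univ,
      Fintype.card_fin]
  induction s with
  | zero =>
    rw [zero_add, pow_one, key, hl, hf, pow_zero, one_mul]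
    simp only [mul_zero, Nat.cast_zero]
    module
  | succ s ih =>
    rw [pow_succ', mul_assoc, key, ih, euler_Rsq_pow_mul hf, mul_smul_comm, ← mul_assoc,
      ← pow_succ']
    push_cast
    module

/-- The quotient map killing the anticommuting variables. -/
noncomputable def body (m n : ℕ) : SuperPoly m n →ₐ[ℝ] MvPolynomial (Fin m) ℝ :=
  Algebra.TensorProduct.lift (AlgHom.id ℝ (MvPolynomial (Fin m) ℝ))
    ((Algebra.ofId ℝ (MvPolynomial (Fin m) ℝ)).comp ExteriorAlgebra.algebraMapInv)
    fun _ _ => Commute.all _ _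

theorem body_tm (p : MvPolynomial (Fin m) ℝ) (w : Grassmann n) :
    body m n (tm p w) = p * algebraMap ℝ _ (ExteriorAlgebra.algebraMapInv w) := rfl

theorem body_polyIncl (p : MvPolynomial (Fin m) ℝ) : body m n (polyIncl m n p) = p := by
  rw [polyIncl_apply, body_tm]; simp

theorem body_Rsq : body m n (Rsq m n) = ∑ i, MvPolynomial.X i * MvPolynomial.X i := by
  have h : ∀ a : Fin n × Fin 2, body m n (X (Sum.inr a)) = 0 := by
    intro a
    rw [X_inr, body_tm, th, ExteriorAlgebra.algebraMapInv]
    simp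
  rw [Rsq_eq_rsq, rsq]
  simp [h, X_inl, body_tm]

/-- Modulo the θ's this is a product in a polynomial ring, which is a domain; R² becomes ∑ x_i²,
nonzero at the point (1, …, 1). -/
theorem Rsq_pow_mul_ne_zero (hm : m ≠ 0) (s : ℕ) {u : SuperPoly m n}
    (hu : u ∈ varsIn m (∅ : Finset (Fin n))) (hu0 : u ≠ 0) : Rsq m n ^ s * u ≠ 0 := by
  obtain ⟨p, rfl⟩ := exists_polyIncl_eq hu
  intro h
  have h1 := congrArg (body m n) h
  rw [map_mul, map_pow, body_Rsq, body_polyIncl, map_zero] at h1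
  have hR : (∑ i, MvPolynomial.X i * MvPolynomial.X i : MvPolynomial (Fin m) ℝ) ≠ 0 := by
    intro h2
    have := congrArg (MvPolynomial.eval fun _ => (1 : ℝ)) h2
    simp at this
    exact hm this
  exact hu0 (by rw [(mul_eq_zero.1 h1).resolve_left (pow_ne_zero _ hR), map_zero])

/-! ### Irreducibility -/

theorem isOspModule_iff {V : Submodule ℝ (SuperPoly m n)} :
    IsOspModule V ↔ IsStable Finset.univ V := by
  constructor
  · intro h i j _ _ f hf
    exact h _ (Submodule.subset_span ⟨(i, j), rfl⟩) f hf
  · intro h D hD f hf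
    have : osp m n ≤ (V.comap (LinearMap.applyₗ f)) := by
      rw [osp, Submodule.span_le]
      rintro _ ⟨⟨i, j⟩, rfl⟩
      exact h i j (by rcases i with i | a <;> simp) (by rcases j with i | a <;> simp) f hf
    exact this hD

theorem mem_sphHarm {k : ℕ} {f : SuperPoly m n} :
    f ∈ sphHarm m n k ↔ euler m n f = (k : ℝ) • f ∧ laplace m n f = 0 := by
  rw [sphHarm, Submodule.mem_inf, mem_homog, LinearMap.mem_ker]

theorem sphHarm_eq_harmIn (k : ℕ) : sphHarm m n k = harmIn m Finset.univ k := by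
  ext f
  rw [mem_sphHarm, mem_harmIn, varsIn_univ]
  simp

theorem isOspModule_sphHarm (k : ℕ) : IsOspModule (sphHarm m n k) := by
  rw [isOspModule_iff]
  intro i j _ _ f hf
  rw [mem_sphHarm] at hf ⊢
  rw [← L_euler, ← L_laplace, hf.1, hf.2, map_smul, map_zero]
  exact ⟨rfl, rfl⟩

theorem isOspModule_RsqPowMul (s : ℕ) {V : Submodule ℝ (SuperPoly m n)} (hV : IsOspModule V) :
    IsOspModule (RsqPowMul s V) := by
  rw [isOspModule_iff] at hV ⊢
  rintro i j hi hj _ ⟨f, hf, rfl⟩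
  exact ⟨L i j f, hV i j hi hj f hf, (L_rsq_pow_mul i j s f).symm⟩

/-- The orthogonal complement with respect to the bilinear form. -/
noncomputable def perp (W : Submodule ℝ (SuperPoly m n)) : Submodule ℝ (SuperPoly m n) where
  carrier := {g | ∀ f ∈ W, form m n f g = 0}
  add_mem' hx hy f hf := by rw [map_add, hx f hf, hy f hf, add_zero]
  zero_mem' f _ := map_zero _
  smul_mem' c x hx f hf := by rw [map_smul, hx f hf, smul_zero]

theorem isOspModule_perp {W : Submodule ℝ (SuperPoly m n)} (hW : IsOspModule W) :
    IsOspModule (perp W) := by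
  rw [isOspModule_iff] at hW ⊢
  intro i j hi hj g hg f hf
  have h := form_L (bar i) (bar j) f g
  have h1 := hg _ (hW (bar i) (bar j) ((active_bar _ _).2 hi) ((active_bar _ _).2 hj) f hf)
  rw [h1, bar_bar, bar_bar] at h
  refine (mul_eq_zero.1 h.symm).resolve_left (neg_ne_zero.2 (mul_ne_zero (mul_ne_zero
    (sgn_ne_zero _ _) (div_ne_zero (lam_ne_zero _) (lam_ne_zero _)))
    (div_ne_zero (lam_ne_zero _) (lam_ne_zero _))))

/-- A nonzero submodule and its complement inside ℋ_k are orthogonal and stable, so the complement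
is zero; a dimension count finishes. -/
theorem isOspIrreducible_sphHarm {k : ℕ} (h0 : m = 0 → k ≤ n) (h1 : m = 1 → k ≤ 2 * n + 1)
    (hk : ¬ (Even m ∧ 4 + 2 * n ≤ 2 * k + m ∧ k + m ≤ 2 + 2 * n)) :
    IsOspIrreducible (sphHarm m n k) := by
  have hcard : (Finset.univ : Finset (Fin n)).card = n := by
    rw [Finset.card_univ, Fintype.card_fin]
  refine ⟨isOspModule_sphHarm k, ?_, fun W hW hWm => or_iff_not_imp_left.2 fun hWn => ?_⟩
  · rw [sphHarm_eq_harmIn]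
    exact harmIn_ne_bot _ k (by rwa [hcard]) (by rwa [hcard])
  · have hV : perp W ⊓ sphHarm m n k = ⊥ := by
      by_contra hV
      have hVm : IsOspModule (perp W ⊓ sphHarm m n k) := fun D hD f hf =>
        ⟨isOspModule_perp hWm D hD f hf.1, isOspModule_sphHarm k D hD f hf.2⟩
      obtain ⟨w, hw, v, hv, hwv⟩ := exists_form_ne_zero Finset.univ k (by rwa [hcard]) W
        (perp W ⊓ sphHarm m n k) (by rwa [← sphHarm_eq_harmIn]) (isOspModule_iff.1 hWm) hWn
        (by rw [← sphHarm_eq_harmIn]; exact inf_le_right) (isOspModule_iff.1 hVm) hV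
      exact hwv (hv.1 w hw)
    have hfin : FiniteDimensional ℝ (sphHarm m n k) := by
      have := finiteDimensional_homog (m := m) (n := n) k
      exact Submodule.finiteDimensional_of_le inf_le_left
    have hfinW : FiniteDimensional ℝ W := Submodule.finiteDimensional_of_le hW
    let Φ : sphHarm m n k →ₗ[ℝ] Module.Dual ℝ W :=
      ((form m n).flip).domRestrict₁₂ (sphHarm m n k) W
    have hΦ : Function.Injective Φ := by
      rw [injective_iff_map_eq_zero]
      intro g hg
      have : (g : SuperPoly m n) ∈ perp W ⊓ sphHarm m n k := by
        refine ⟨fun f hf => ?_, g.2⟩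
        exact congrArg (fun φ => φ ⟨f, hf⟩) hg
      rw [hV, Submodule.mem_bot] at this
      exact Subtype.ext this
    have hle := LinearMap.finrank_le_finrank_of_injective hΦ
    rw [Subspace.dual_finrank_eq] at hle
    exact Submodule.eq_of_le_of_finrank_le hW hle

/-- Both non-vanishing and properness are witnessed by classical harmonics, of degrees d and k; this
is where m ≥ 2 enters. The relation `hsd` says M + 2d + 2(s - 1) = 0, the vanishing of the factor in
`laplace_Rsq_pow_mul`. -/
theorem RsqPowMul_sphHarm {s d k : ℕ} (hs : s ≠ 0) (hm : 2 ≤ m) (hk : k = d + 2 * s)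
    (hsd : m + 2 * d + 2 * s = 2 * n + 2) :
    IsOspModule (RsqPowMul s (sphHarm m n d)) ∧ RsqPowMul s (sphHarm m n d) ≠ ⊥ ∧
      RsqPowMul s (sphHarm m n d) < sphHarm m n k := by
  refine ⟨isOspModule_RsqPowMul s (isOspModule_sphHarm d), ?_, lt_of_le_of_ne ?_ ?_⟩
  · obtain ⟨u, hu, hu0⟩ := exists_mem_harmIn_empty (n := n) hm d
    rw [Submodule.ne_bot_iff]
    refine ⟨_, ⟨u, ?_, rfl⟩, Rsq_pow_mul_ne_zero (by omega) s (mem_harmIn.1 hu).1 hu0⟩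
    rw [sphHarm_eq_harmIn]
    exact harmIn_mono (Finset.empty_subset _) _ hu
  · rintro _ ⟨f, hf, rfl⟩
    obtain ⟨he, hl⟩ := mem_sphHarm.1 hf
    obtain ⟨s, rfl⟩ := Nat.exists_eq_succ_of_ne_zero hs
    refine mem_sphHarm.2 ⟨?_, ?_⟩
    · refine (euler_Rsq_pow_mul he _).trans ?_
      rw [hk]; push_cast; rfl
    · refine (laplace_Rsq_pow_mul he hl s).trans ?_
      have : (m : ℝ) + 2 * d + 2 * (s + 1) = 2 * n + 2 := by exact_mod_cast hsd
      have h2 : (m : ℝ) - 2 * n + 2 * d + 2 * s = 0 := by linarith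
      rw [h2, mul_zero, zero_smul]
  · intro h
    obtain ⟨u, hu, hu0⟩ := exists_mem_harmIn_empty (n := n) hm k
    have hmem : u ∈ RsqPowMul s (sphHarm m n d) := by
      rw [h, sphHarm_eq_harmIn]
      exact harmIn_mono (Finset.empty_subset _) _ hu
    obtain ⟨f, -, hf⟩ := hmem
    obtain ⟨s, rfl⟩ := Nat.exists_eq_succ_of_ne_zero hs
    have hf' : Rsq m n * (Rsq m n ^ s * f) = u := by
      rw [← mul_assoc, ← pow_succ']; exact hf
    obtain ⟨huv, -, hul⟩ := mem_harmIn.1 hu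
    have hpos := form_self_pos huv hu0
    have : form m n (Rsq m n * (Rsq m n ^ s * f)) u = 0 := by
      rw [Rsq_eq_rsq, form_rsq_mul _ (by rw [varsIn_univ]; trivial), hul, map_zero]
    rw [hf'] at this
    exact hpos.ne' this

end SuperHarm


/-! ### The exceptional range in terms of the superdimension -/

theorem mainTheorem1 (m n k : ℕ) (h0 : m = 0 → k ≤ n) (h1 : m = 1 → k ≤ 2 * n + 1) :
    ((¬ ∃ p : ℕ, SuperHarm.superdim m n = -2 * (p : ℤ)) →
      SuperHarm.IsOspIrreducible (SuperHarm.sphHarm m n k)) ∧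
    ((∃ p : ℕ, SuperHarm.superdim m n = -2 * (p : ℤ)) →
      (SuperHarm.IsOspIrreducible (SuperHarm.sphHarm m n k) ↔
        (k : ℤ) > 2 - SuperHarm.superdim m n ∨ (k : ℤ) < 2 - SuperHarm.superdim m n / 2) ∧
      (2 - SuperHarm.superdim m n / 2 ≤ (k : ℤ) ∧ (k : ℤ) ≤ 2 - SuperHarm.superdim m n →
        ∃ s d : ℕ, 2 * (s : ℤ) = 2 * (k : ℤ) + SuperHarm.superdim m n - 2 ∧
          (d : ℤ) = 2 - SuperHarm.superdim m n - (k : ℤ) ∧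
          SuperHarm.IsOspModule (SuperHarm.RsqPowMul s (SuperHarm.sphHarm m n d)) ∧
          SuperHarm.RsqPowMul s (SuperHarm.sphHarm m n d) ≠ ⊥ ∧
          SuperHarm.RsqPowMul s (SuperHarm.sphHarm m n d) < SuperHarm.sphHarm m n k)) := by
  constructor
  · intro h
    -- With m = 2r, M = -2(n - r). The subtraction does not truncate, since a nonempty exceptional
    -- range forces m ≤ 2n.
    refine SuperHarm.isOspIrreducible_sphHarm h0 h1 fun ⟨⟨r, hr⟩, h2, h3⟩ => h ⟨n - r, ?_⟩
    rw [SuperHarm.superdim]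
    omega
  · rintro ⟨p, hp⟩
    have hmp : m + 2 * p = 2 * n := by
      rw [SuperHarm.superdim] at hp; omega
    have key : 2 - SuperHarm.superdim m n / 2 ≤ (k : ℤ) ∧ (k : ℤ) ≤ 2 - SuperHarm.superdim m n →
        ∃ s d : ℕ, 2 * (s : ℤ) = 2 * (k : ℤ) + SuperHarm.superdim m n - 2 ∧
          (d : ℤ) = 2 - SuperHarm.superdim m n - (k : ℤ) ∧
          SuperHarm.IsOspModule (SuperHarm.RsqPowMul s (SuperHarm.sphHarm m n d)) ∧
          SuperHarm.RsqPowMul s (SuperHarm.sphHarm m n d) ≠ ⊥ ∧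
          SuperHarm.RsqPowMul s (SuperHarm.sphHarm m n d) < SuperHarm.sphHarm m n k := by
      rw [hp]
      rintro ⟨h2, h3⟩
      -- These are k + M/2 - 1 and 2 - M - k for M = -2p, not truncated because 2 + p ≤ k ≤ 2 + 2p.
      -- In the next line m ≥ 2 holds because m is even, and m = 0 would give p = n and k ≥ n + 2.
      refine ⟨k - p - 1, 2 + 2 * p - k, by omega, by omega, ?_⟩
      exact SuperHarm.RsqPowMul_sphHarm (by omega) (by omega) (by omega) (by omega)
    refine ⟨⟨fun hirr => ?_, fun h => ?_⟩, key⟩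
    · by_contra hcon
      obtain ⟨s, d, -, -, hmod, hne, hlt⟩ := key (by omega)
      rcases hirr.2.2 _ hlt.le hmod with h | h
      · exact hne h
      · exact hlt.ne h
    · refine SuperHarm.isOspIrreducible_sphHarm h0 h1 fun ⟨_, h2, h3⟩ => ?_
      rw [hp] at h
      omega
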